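/- There is a universal constant $C>0$ such that the following holds. Fix $\alpha\in(2/3,1)$ and let $d_n\le n$ be integers with $d_n\ge n^{\alpha}$ for all sufficiently large $n$. For each $n$ let $A_n=(a_{ij})_{1\le i,j\le n}$ be a random matrix with independent entries such that (1) $a_{ij}$ is uniformly distributed on $\{-1,1\}$ whenever $|i-j|\le d_n$, and (2) every other $a_{ij}$ is an arbitrary integer-valued random variable (possibly identically zero). Then, for all sufficiently large $n$, $$\mathbb{P}(A_n\text{ is singular})\le \exp(-C n^{\alpha/2}).$$ More precisely, there is $N=N(\alpha)$ such that this bound holds for every $n\ge N$, every integer $d_n$ with $n^\alpha\le d_n\le n$, and every random matrix $A_n$ satisfying the above conditions. The conditions on $A_n$ are satisfied in particular by the following two models with independent entries. Periodic band matrices of bandwidth $d_n$: $a_{ij}=0$ if $d_n<|i-j|<n-d_n$, and $a_{ij}$ is uniform on $\{-1,1\}$ if $|i-j|\le d_n$ or $|i-j|\ge n-d_n$. Block band matrices of block size $d_n$: $n=m d_n$ with $m\ge 3$, and $A_n$ is an $m\times m$ array of $d_n\times d_n$ blocks in which the diagonal blocks, the blocks directly above and below the diagonal, and the upper right and lower left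 corner blocks have uniform $\{-1,1\}$ entries, while all other blocks are zero. -/

import Mathlib

open MeasureTheory ProbabilityTheory

/-- The integer random variable `X` is uniformly distributed on `{-1, 1}`. -/
def IsUniformSign {Ω : Type*} [MeasurableSpace Ω] (P : Measure Ω) (X : Ω → ℤ) : Prop :=
  P.real {ω | X ω = 1} = 1 / 2 ∧ P.real {ω | X ω = -1} = 1 / 2

/-- The `n × n` random matrix `A` has jointly independent integer-valued random entries. -/
structure HasIndepEntries {Ω : Type*} [MeasurableSpace Ω] (P : Measure Ω) {n : ℕ}
    (A : Fin n → Fin n → Ω → ℤ) : Prop where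
  measurable : ∀ i j, Measurable (A i j)
  indep : iIndepFun (fun q : Fin n × Fin n => A q.1 q.2) P

/-- The general band model of bandwidth `d`: independent integer entries, uniform on `{-1, 1}`
whenever `|i - j| ≤ d`; nothing else is required of the laws of the other entries. -/
structure IsRandomBand {Ω : Type*} [MeasurableSpace Ω] (P : Measure Ω) {n : ℕ} (d : ℤ)
    (A : Fin n → Fin n → Ω → ℤ) : Prop extends HasIndepEntries P A where
  uniform : ∀ i j : Fin n, |(i : ℤ) - (j : ℤ)| ≤ d → IsUniformSign P (A i j)

/-- The periodic band model of bandwidth `d`. -/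
structure IsPeriodicBand {Ω : Type*} [MeasurableSpace Ω] (P : Measure Ω) {n : ℕ} (d : ℤ)
    (A : Fin n → Fin n → Ω → ℤ) : Prop extends HasIndepEntries P A where
  uniform : ∀ i j : Fin n,
    (|(i : ℤ) - (j : ℤ)| ≤ d ∨ (n : ℤ) - d ≤ |(i : ℤ) - (j : ℤ)|) → IsUniformSign P (A i j)
  zero : ∀ i j : Fin n,
    d < |(i : ℤ) - (j : ℤ)| → |(i : ℤ) - (j : ℤ)| < (n : ℤ) - d → ∀ᵐ ω ∂P, A i j ω = 0

/-- With `m` blocks, the blocks number `k` and `l` (counted from `0`) are equal or cyclically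
adjacent. -/
def CyclicallyNear (m k l : ℕ) : Prop :=
  |(k : ℤ) - (l : ℤ)| ≤ 1 ∨ |(k : ℤ) - (l : ℤ)| = (m : ℤ) - 1

/-- The block band model: an `m × m` array of `d × d` blocks (`m ≥ 3`), where the diagonal blocks,
the blocks next to the diagonal and the two corner blocks have uniform `{-1, 1}` entries, and all
the other blocks vanish. The row (or column) `i`, counted from `0`, lies in the block `i / d`. -/
structure IsBlockBand {Ω : Type*} [MeasurableSpace Ω] (P : Measure Ω) {n : ℕ} (m d : ℕ)
    (A : Fin n → Fin n → Ω → ℤ) : Prop extends HasIndepEntries P A where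
  three_le : 3 ≤ m
  size : n = m * d
  uniform : ∀ i j : Fin n,
    CyclicallyNear m ((i : ℕ) / d) ((j : ℕ) / d) → IsUniformSign P (A i j)
  zero : ∀ i j : Fin n,
    ¬ CyclicallyNear m ((i : ℕ) / d) ((j : ℕ) / d) → ∀ᵐ ω ∂P, A i j ω = 0

/-- The event that the random matrix `A` is singular, as a real matrix. -/
def singularEvent {Ω : Type*} {n : ℕ} (A : Fin n → Fin n → Ω → ℤ) : Set Ω :=
  {ω | (Matrix.of fun i j => (A i j ω : ℝ)).det = 0}

/-! Work modulo a prime `p` slightly below `exp (√b / 64)`, where `b` is about half the bandwidth. A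
singular integer matrix is singular modulo `p`, and its kernel there contains a line, so `(p - 1) *
P(singular)` is at most the sum of `P(Av = 0)` over all `v` modulo `p`. Cut the indices into `n / b`
blocks so short that all entries of the diagonal blocks are uniform signs. Fourier inversion and
independence bound `P(Av = 0)` by a product over rows of `atomBound` of `v` on the row's own block:
an entry outside the diagonal blocks enters through a characteristic function of modulus at most 1,
whatever its law. The sum over `v` then factors over blocks, each factor is at most 32
(`sum_atomBound_pow_le`), and the probability is at most `32 ^ (n / b) * 4 * exp (-√b / 64)`. The
first factor is harmless because `n ^ (1 - α)` is negligible against `n ^ (α / 2)` when `α > 2/3`.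

The heart is the bound for one block of size `L`. The zero vector contributes 1; sparse vectors are
few and have `atomBound ≤ 3/4`. Otherwise `atomBound w ≤ F / p` with `F = expSum w`. Sampling `k`
entries of `w` at random gives a weight on frequencies with average total `Q_k = defectMoment w k`,
decreasing from `Q_0 = p`. If `Q_(k+1)` is close to `Q_k` while `Q_k` is large compared with `F`,
some `k`-tuple has nearly all entries of `w` in its spectrum, a set of size `O(p / Q_k)`: such
compressible vectors are few enough (`sum_compressible`). If this never happens, `Q_k` falls
geometrically to about `F`, which bounds the set of frequencies with defect at most `√L / 16`. By
Cauchy-Davenport doubling, a lower level set is then just `{0}`, so `F ≤ 1 + 3 / L`, and even all `p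
^ L` such vectors together contribute at most `e ^ 3`. -/

/-! ### Real parts of additive characters modulo a prime -/

section Characters

variable {p : ℕ} [Fact p.Prime]

/-- The real part `cos (2πx/p)` of the standard additive character of `ZMod p`. -/
noncomputable def cosChar (x : ZMod p) : ℝ := (ZMod.stdAddChar x).re

theorem norm_stdAddChar (x : ZMod p) : ‖ZMod.stdAddChar x‖ = 1 := by
  exact Circle.norm_coe (ZMod.toCircle x)

theorem normSq_stdAddChar (x : ZMod p) :
    (ZMod.stdAddChar x).re ^ 2 + (ZMod.stdAddChar x).im ^ 2 = 1 := by
  have h := Complex.sq_norm (ZMod.stdAddChar x)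
  rw [norm_stdAddChar, Complex.normSq_apply] at h
  linarith

theorem abs_cosChar_le_one (x : ZMod p) : |cosChar x| ≤ 1 := by
  have h := Complex.abs_re_le_norm (ZMod.stdAddChar x)
  rwa [norm_stdAddChar] at h

theorem cosChar_le_one (x : ZMod p) : cosChar x ≤ 1 := (abs_le.1 (abs_cosChar_le_one x)).2

theorem neg_one_le_cosChar (x : ZMod p) : -1 ≤ cosChar x := (abs_le.1 (abs_cosChar_le_one x)).1

@[simp] theorem cosChar_zero : cosChar (0 : ZMod p) = 1 := by simp [cosChar]

theorem cosChar_sq (x : ZMod p) : cosChar x ^ 2 = (1 + cosChar (2 * x)) / 2 := by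
  have h := normSq_stdAddChar x
  have h2 : ZMod.stdAddChar (2 * x) = ZMod.stdAddChar x * ZMod.stdAddChar x := by
    rw [two_mul, AddChar.map_add_eq_mul]
  unfold cosChar
  rw [h2, Complex.mul_re]
  nlinarith

/-- Since `1 - Re χ = |1 - χ|² / 2`, this is `|u + v|² ≤ 2|u|² + 2|v|²`. It makes `phaseDefect`
behave like a squared norm. -/
theorem one_sub_cosChar_add (x y : ZMod p) :
    1 - cosChar (x + y) ≤ 2 * (1 - cosChar x) + 2 * (1 - cosChar y) := by
  have hx := normSq_stdAddChar x
  have hy := normSq_stdAddChar y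
  unfold cosChar
  rw [AddChar.map_add_eq_mul, Complex.mul_re]
  set a := (ZMod.stdAddChar x).re
  set b := (ZMod.stdAddChar x).im
  set c := (ZMod.stdAddChar y).re
  set d := (ZMod.stdAddChar y).im
  have e : 2 * (1 - a) + 2 * (1 - c) - (1 - (a * c - b * d))
      = ((a + c - 2) ^ 2 + (b - d) ^ 2) / 2 := by
    linear_combination (-1 / 2) * hx + (-1 / 2) * hy
  have : 0 ≤ ((a + c - 2) ^ 2 + (b - d) ^ 2) / 2 := by positivity
  linarith

theorem sum_stdAddChar_mul (b : ZMod p) :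
    ∑ x : ZMod p, ZMod.stdAddChar (x * b) = if b = 0 then (p : ℂ) else 0 := by
  have h := AddChar.sum_mulShift b (ZMod.isPrimitive_stdAddChar p)
  rw [h]
  simp [ZMod.card]

theorem sum_cosChar_mul {b : ZMod p} (hb : b ≠ 0) : ∑ x : ZMod p, cosChar (x * b) = 0 := by
  have h := congrArg Complex.re (sum_stdAddChar_mul b)
  rw [if_neg hb, Complex.re_sum] at h
  simpa [cosChar] using h

/-- One half of Parseval's identity, for real parts. -/
theorem sum_sq_cosTransform_le (G : ZMod p → ℝ) :
    ∑ x : ZMod p, (∑ t, G t * cosChar (t * x)) ^ 2 ≤ p * ∑ t, G t ^ 2 := by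
  -- Dropping the imaginary part of the transform is the only loss; the rest is Parseval's identity.
  have h1 : ∀ x : ZMod p, (∑ t, G t * cosChar (t * x)) ^ 2 ≤
      ((∑ t, (G t : ℂ) * ZMod.stdAddChar (t * x)) *
        (∑ s, (G s : ℂ) * ZMod.stdAddChar (-(s * x)))).re := by
    intro x
    have hc : (∑ s, (G s : ℂ) * ZMod.stdAddChar (-(s * x)))
        = (starRingEnd ℂ) (∑ t, (G t : ℂ) * ZMod.stdAddChar (t * x)) := by
      rw [map_sum]
      refine Finset.sum_congr rfl fun s _ => ?_
      rw [map_mul, Complex.conj_ofReal, AddChar.map_neg_eq_conj]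
    rw [hc, Complex.mul_conj, Complex.ofReal_re, Complex.normSq_apply]
    have : (∑ t, (G t : ℂ) * ZMod.stdAddChar (t * x)).re = ∑ t, G t * cosChar (t * x) := by
      rw [Complex.re_sum]
      exact Finset.sum_congr rfl fun t _ => by rw [Complex.re_ofReal_mul]; rfl
    rw [this]
    nlinarith [mul_self_nonneg (∑ t, (G t : ℂ) * ZMod.stdAddChar (t * x)).im]
  refine (Finset.sum_le_sum fun x _ => h1 x).trans (le_of_eq ?_)
  rw [← Complex.re_sum]
  have h2 : ∑ x : ZMod p, (∑ t, (G t : ℂ) * ZMod.stdAddChar (t * x)) *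
        (∑ s, (G s : ℂ) * ZMod.stdAddChar (-(s * x))) = ((p * ∑ t, G t ^ 2 : ℝ) : ℂ) := by
    simp_rw [Finset.sum_mul_sum]
    rw [Finset.sum_comm]
    have h3 : ∀ t : ZMod p, ∑ x : ZMod p, ∑ s : ZMod p, (G t : ℂ) * ZMod.stdAddChar (t * x) *
        ((G s : ℂ) * ZMod.stdAddChar (-(s * x))) = p * (G t : ℂ) ^ 2 := by
      intro t
      rw [Finset.sum_comm]
      have h4 : ∀ s : ZMod p, ∑ x : ZMod p, (G t : ℂ) * ZMod.stdAddChar (t * x) *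
        ((G s : ℂ) * ZMod.stdAddChar (-(s * x))) =
          (G t : ℂ) * G s * if t - s = 0 then (p : ℂ) else 0 := by
        intro s
        rw [← sum_stdAddChar_mul, Finset.mul_sum]
        refine Finset.sum_congr rfl fun x _ => ?_
        have : x * (t - s) = t * x + -(s * x) := by ring
        rw [this, AddChar.map_add_eq_mul]
        ring
      simp_rw [h4, sub_eq_zero]
      simp
      ring
    simp_rw [h3]
    push_cast
    rw [Finset.mul_sum]
  rw [h2, Complex.ofReal_re]

end Characters

/-! ### Phase defect, its moments, and bounds for the largest atom -/

section PhaseDefect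

variable {p : ℕ} [Fact p.Prime] {ι : Type*} [Fintype ι]

/-- The sum `∑ j, sin² (π t w_j / p)`, which measures how far the phases `t * w j` are from `0`. -/
noncomputable def phaseDefect (w : ι → ZMod p) (t : ZMod p) : ℝ :=
  ∑ j, (1 - cosChar (t * w j)) / 2

/-- The power sums of the normalized correlation `1 - phaseDefect w t / card ι`. -/
noncomputable def defectMoment (w : ι → ZMod p) (k : ℕ) : ℝ :=
  ∑ t, (1 - phaseDefect w t / Fintype.card ι) ^ k

noncomputable def expSum (w : ι → ZMod p) : ℝ := ∑ t, Real.exp (-(phaseDefect w t / 2))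

/-- The Fourier-analytic bound for the largest atom of `∑ j, ε_j w_j` with independent uniform
signs `ε_j`. -/
noncomputable def atomBound (w : ι → ZMod p) : ℝ :=
  (p : ℝ)⁻¹ * ∑ t, ∏ j, |cosChar (t * w j)|

theorem phaseDefect_nonneg (w : ι → ZMod p) (t : ZMod p) : 0 ≤ phaseDefect w t :=
  Finset.sum_nonneg fun j _ => by linarith [cosChar_le_one (t * w j)]

theorem phaseDefect_le_card (w : ι → ZMod p) (t : ZMod p) :
    phaseDefect w t ≤ Fintype.card ι := by
  have : phaseDefect w t ≤ ∑ _j : ι, (1 : ℝ) :=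
    Finset.sum_le_sum fun j _ => by linarith [neg_one_le_cosChar (t * w j)]
  simpa using this

@[simp] theorem phaseDefect_zero (w : ι → ZMod p) : phaseDefect w 0 = 0 := by
  simp [phaseDefect]

theorem phaseDefect_add_le (w : ι → ZMod p) (s t : ZMod p) :
    phaseDefect w (s + t) ≤ 2 * phaseDefect w s + 2 * phaseDefect w t := by
  unfold phaseDefect
  rw [Finset.mul_sum, Finset.mul_sum, ← Finset.sum_add_distrib]
  refine Finset.sum_le_sum fun j _ => ?_
  have := one_sub_cosChar_add (s * w j) (t * w j)
  rw [add_mul]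
  linarith

theorem sum_phaseDefect (w : ι → ZMod p) :
    ∑ t, phaseDefect w t = p * ((Finset.univ.filter fun j => w j ≠ 0).card : ℝ) / 2 := by
  unfold phaseDefect
  rw [Finset.sum_comm]
  have h : ∀ j, ∑ t : ZMod p, (1 - cosChar (t * w j)) / 2 = if w j ≠ 0 then (p : ℝ) / 2 else 0 := by
    intro j
    split_ifs with hj
    · rw [← Finset.sum_div, Finset.sum_sub_distrib, sum_cosChar_mul hj]
      simp [ZMod.card]
    · have : w j = 0 := by simpa using hj
      simp [this]
  simp_rw [h]
  rw [← Finset.sum_filter, Finset.sum_const, nsmul_eq_mul]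
  ring

theorem one_sub_phaseDefect_nonneg (w : ι → ZMod p) (t : ZMod p) :
    0 ≤ 1 - phaseDefect w t / Fintype.card ι :=
  sub_nonneg.2 (div_le_one_of_le₀ (phaseDefect_le_card w t) (by positivity))

theorem one_sub_phaseDefect_le_one (w : ι → ZMod p) (t : ZMod p) :
    1 - phaseDefect w t / Fintype.card ι ≤ 1 := by
  have := phaseDefect_nonneg w t
  have : 0 ≤ phaseDefect w t / Fintype.card ι := by positivity
  linarith

theorem defectMoment_zero (w : ι → ZMod p) : defectMoment w 0 = p := by
  simp [defectMoment, ZMod.card]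

theorem defectMoment_succ_le (w : ι → ZMod p) (k : ℕ) :
    defectMoment w (k + 1) ≤ defectMoment w k :=
  Finset.sum_le_sum fun t _ => pow_le_pow_of_le_one (one_sub_phaseDefect_nonneg w t)
    (one_sub_phaseDefect_le_one w t) k.le_succ

theorem one_le_defectMoment (w : ι → ZMod p) (k : ℕ) : 1 ≤ defectMoment w k := by
  have := Finset.single_le_sum (f := fun t => (1 - phaseDefect w t / Fintype.card ι) ^ k)
    (fun t _ => pow_nonneg (one_sub_phaseDefect_nonneg w t) k) (Finset.mem_univ 0)
  simpa [defectMoment] using this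

theorem one_le_expSum (w : ι → ZMod p) : 1 ≤ expSum w := by
  have := Finset.single_le_sum (f := fun t => Real.exp (-(phaseDefect w t / 2)))
    (fun t _ => (Real.exp_pos _).le) (Finset.mem_univ 0)
  simpa [expSum] using this

theorem atomBound_nonneg (w : ι → ZMod p) : 0 ≤ atomBound w :=
  mul_nonneg (by positivity) (Finset.sum_nonneg fun _ _ => Finset.prod_nonneg fun _ _ =>
    abs_nonneg _)

theorem atomBound_le_one (w : ι → ZMod p) : atomBound w ≤ 1 := by
  have hp : (0 : ℝ) < p := by exact_mod_cast (Fact.out : p.Prime).pos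
  have : ∑ t : ZMod p, ∏ j, |cosChar (t * w j)| ≤ ∑ _t : ZMod p, (1 : ℝ) :=
    Finset.sum_le_sum fun t _ => Finset.prod_le_one (fun _ _ => abs_nonneg _)
      fun j _ => abs_cosChar_le_one _
  rw [atomBound, inv_mul_le_iff₀ hp]
  simpa [ZMod.card] using this

theorem two_ne_zero_zmod (hp2 : p ≠ 2) : (2 : ZMod p) ≠ 0 := by
  intro h
  have h' : ((2 : ℕ) : ZMod p) = 0 := by exact_mod_cast h
  rw [ZMod.natCast_eq_zero_iff] at h'
  exact hp2 ((Nat.prime_dvd_prime_iff_eq Fact.out Nat.prime_two).1 h')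

theorem abs_cosChar_le_exp (x : ZMod p) :
    |cosChar x| ≤ Real.exp (-((1 - cosChar (2 * x)) / 2 / 2)) := by
  have h1 : |cosChar x| ^ 2 ≤ (Real.exp (-((1 - cosChar (2 * x)) / 2 / 2))) ^ 2 := by
    rw [sq_abs, cosChar_sq, ← Real.exp_nat_mul]
    have := Real.add_one_le_exp (((2 : ℕ) : ℝ) * -((1 - cosChar (2 * x)) / 2 / 2))
    push_cast at this ⊢
    linarith
  exact le_of_sq_le_sq h1 (Real.exp_pos _).le

/-- Factor by factor, `|cos θ| ≤ exp (-sin² θ / 2)`. This produces the defect at `2 * t`, and `t ↦ 2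
* t` permutes the residues because `p` is odd. -/
theorem atomBound_le_expSum (hp2 : p ≠ 2) (w : ι → ZMod p) : atomBound w ≤ expSum w / p := by
  rw [atomBound, div_eq_inv_mul]
  refine mul_le_mul_of_nonneg_left ?_ (by positivity)
  have h2 := two_ne_zero_zmod hp2
  have : expSum w = ∑ t, Real.exp (-(phaseDefect w (2 * t) / 2)) :=
    (Equiv.sum_comp (Equiv.mulLeft₀ (2 : ZMod p) h2)
      fun t => Real.exp (-(phaseDefect w t / 2))).symm
  rw [this]
  refine Finset.sum_le_sum fun t _ => ?_
  calc ∏ j, |cosChar (t * w j)|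
      ≤ ∏ j, Real.exp (-((1 - cosChar (2 * (t * w j))) / 2 / 2)) :=
        Finset.prod_le_prod (fun _ _ => abs_nonneg _) fun j _ => abs_cosChar_le_exp _
    _ = _ := by
        rw [← Real.exp_sum, phaseDefect, Finset.sum_neg_distrib, Finset.sum_div]
        simp_rw [mul_assoc]

/-- Keep one nonzero coordinate and linearize: `|c| ≤ (1 + c²) / 2 = 3/4 + cos 2θ / 4` for `c = cos
θ`. The cosine averages to zero over `t`. -/
theorem atomBound_le_three_quarters (hp2 : p ≠ 2) {w : ι → ZMod p} (hw : w ≠ 0) :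
    atomBound w ≤ 3 / 4 := by
  obtain ⟨i, hi⟩ := Function.ne_iff.1 hw
  have hp : (0 : ℝ) < p := by exact_mod_cast (Fact.out : p.Prime).pos
  rw [atomBound, inv_mul_le_iff₀ hp]
  calc ∑ t, ∏ j, |cosChar (t * w j)| ≤ ∑ t, (3 / 4 + cosChar (t * (2 * w i)) / 4) := by
        refine Finset.sum_le_sum fun t _ => ?_
        calc ∏ j, |cosChar (t * w j)| ≤ |cosChar (t * w i)| := by
              classical
              rw [← Finset.mul_prod_erase _ _ (Finset.mem_univ i)]
              exact mul_le_of_le_one_right (abs_nonneg _) (Finset.prod_le_one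
                (fun _ _ => abs_nonneg _) fun j _ => abs_cosChar_le_one _)
          _ ≤ _ := by
              have h := cosChar_sq (t * w i)
              have e : t * (2 * w i) = 2 * (t * w i) := by ring
              rw [e]
              nlinarith [sq_abs (cosChar (t * w i)), sq_nonneg (|cosChar (t * w i)| - 1)]
    _ = p * (3 / 4) := by
        rw [Finset.sum_add_distrib, ← Finset.sum_div _ fun t => cosChar (t * (2 * w i)),
          sum_cosChar_mul (mul_ne_zero (two_ne_zero_zmod hp2) hi)]
        simp [ZMod.card]

end PhaseDefect

/-! ### Tuples of entries, their spectra, and the count of compressible vectors -/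

theorem sum_biUnion_le_sum_sum {α β : Type*} [DecidableEq α] {f : α → ℝ} (hf : ∀ a, 0 ≤ f a)
    (s : Finset β) (T : β → Finset α) :
    ∑ a ∈ s.biUnion T, f a ≤ ∑ b ∈ s, ∑ a ∈ T b, f a := by
  classical
  induction s using Finset.induction_on with
  | empty => simp
  | insert b s hb ih =>
    rw [Finset.biUnion_insert, Finset.sum_insert hb]
    have h := Finset.sum_union_inter (s₁ := T b) (s₂ := s.biUnion T) (f := f)
    have h0 : 0 ≤ ∑ a ∈ T b ∩ s.biUnion T, f a := Finset.sum_nonneg fun a _ => hf a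
    linarith

section Tuples

variable {p : ℕ} [Fact p.Prime] {k : ℕ}

/-- The characteristic function of `∑ ξ_i z_i` with independent `ξ_i` equal to `-1, 0, 1` with
probabilities `1/4, 1/2, 1/4`; this choice keeps it nonnegative. -/
noncomputable def tupleWeight (z : Fin k → ZMod p) (t : ZMod p) : ℝ :=
  ∏ i, (1 + cosChar (t * z i)) / 2

noncomputable def tupleMass (z : Fin k → ZMod p) : ℝ := ∑ t, tupleWeight z t

/-- The large spectrum of the weight `tupleWeight z`. -/
noncomputable def tupleSpectrum (z : Fin k → ZMod p) : Finset (ZMod p) :=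
  Finset.univ.filter fun x =>
    ∑ t, tupleWeight z t * ((1 - cosChar (t * x)) / 2) ≤ tupleMass z / 4

theorem tupleWeight_nonneg (z : Fin k → ZMod p) (t : ZMod p) : 0 ≤ tupleWeight z t :=
  Finset.prod_nonneg fun i _ => by linarith [neg_one_le_cosChar (t * z i)]

theorem tupleWeight_le_one (z : Fin k → ZMod p) (t : ZMod p) : tupleWeight z t ≤ 1 :=
  Finset.prod_le_one (fun i _ => by linarith [neg_one_le_cosChar (t * z i)])
    fun i _ => by linarith [cosChar_le_one (t * z i)]

theorem one_le_tupleMass (z : Fin k → ZMod p) : 1 ≤ tupleMass z := by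
  have := Finset.single_le_sum (f := tupleWeight z) (fun t _ => tupleWeight_nonneg z t)
    (Finset.mem_univ 0)
  simpa [tupleWeight, tupleMass] using this

theorem tupleMass_le (z : Fin k → ZMod p) : tupleMass z ≤ p := by
  have : tupleMass z ≤ ∑ _t : ZMod p, (1 : ℝ) :=
    Finset.sum_le_sum fun t _ => tupleWeight_le_one z t
  simpa [ZMod.card] using this

/-- On the spectrum the cosine transform of the weight is at least half the mass. By Parseval the
squares sum to at most `p * tupleMass z`, as the weight lies in `[0, 1]`. -/
theorem card_tupleSpectrum_mul_le (z : Fin k → ZMod p) :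
    ((tupleSpectrum z).card : ℝ) * tupleMass z ≤ 4 * p := by
  have h1 := one_le_tupleMass z
  have hx : ∀ x ∈ tupleSpectrum z,
      (tupleMass z / 2) ^ 2 ≤ (∑ t, tupleWeight z t * cosChar (t * x)) ^ 2 := by
    intro x hx
    have hx' := (Finset.mem_filter.1 hx).2
    have e : ∑ t, tupleWeight z t * ((1 - cosChar (t * x)) / 2)
        = (tupleMass z - ∑ t, tupleWeight z t * cosChar (t * x)) / 2 := by
      rw [tupleMass, ← Finset.sum_sub_distrib, Finset.sum_div]
      exact Finset.sum_congr rfl fun t _ => by ring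
    rw [e] at hx'
    exact pow_le_pow_left₀ (by linarith) (by linarith) 2
  have h2 : ((tupleSpectrum z).card : ℝ) * (tupleMass z / 2) ^ 2 ≤ p * tupleMass z := by
    calc ((tupleSpectrum z).card : ℝ) * (tupleMass z / 2) ^ 2
        = ∑ _x ∈ tupleSpectrum z, (tupleMass z / 2) ^ 2 := by simp
      _ ≤ ∑ x ∈ tupleSpectrum z, (∑ t, tupleWeight z t * cosChar (t * x)) ^ 2 :=
          Finset.sum_le_sum hx
      _ ≤ ∑ x, (∑ t, tupleWeight z t * cosChar (t * x)) ^ 2 :=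
          Finset.sum_le_sum_of_subset_of_nonneg (Finset.subset_univ _) fun _ _ _ => sq_nonneg _
      _ ≤ p * ∑ t, tupleWeight z t ^ 2 := sum_sq_cosTransform_le _
      _ ≤ p * tupleMass z := by
          refine mul_le_mul_of_nonneg_left (Finset.sum_le_sum fun t _ => ?_) (by positivity)
          nlinarith [tupleWeight_nonneg z t, tupleWeight_le_one z t]
  have h3 : ((tupleSpectrum z).card : ℝ) * tupleMass z * tupleMass z ≤ 4 * p * tupleMass z := by
    nlinarith
  exact le_of_mul_le_mul_right h3 (by linarith)

variable {ι : Type*} [Fintype ι]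

/-- With the `k` positions chosen independently, the average of the product is the product of the
averages. -/
theorem sum_tupleWeight_comp (w : ι → ZMod p) (k : ℕ) (t : ZMod p) (hι : 0 < Fintype.card ι) :
    ∑ I : Fin k → ι, tupleWeight (w ∘ I) t =
      (Fintype.card ι : ℝ) ^ k * (1 - phaseDefect w t / Fintype.card ι) ^ k := by
  have hL : (0 : ℝ) < Fintype.card ι := by exact_mod_cast hι
  have h := Finset.prod_univ_sum (fun _ : Fin k => (Finset.univ : Finset ι))
    (fun _ j => (1 + cosChar (t * w j)) / 2)
  rw [Fintype.piFinset_univ] at h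
  have e : ∑ j, (1 + cosChar (t * w j)) / 2 = Fintype.card ι - phaseDefect w t := by
    rw [phaseDefect, eq_sub_iff_add_eq, ← Finset.sum_add_distrib]
    have : ∀ j, (1 + cosChar (t * w j)) / 2 + (1 - cosChar (t * w j)) / 2 = 1 := fun j => by ring
    simp [this]
  rw [← mul_pow, mul_sub, mul_one, mul_div_cancel₀ _ hL.ne', ← e]
  simpa [tupleWeight] using h.symm

/-- If consecutive moments of `w` are close, then some tuple of entries of `w` has large mass and
contains almost all the entries of `w` in its spectrum. -/
theorem exists_tuple_of_defectMoment (w : ι → ZMod p) (k : ℕ) (hι : 0 < Fintype.card ι) {δ : ℝ}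
    (hδ : 0 < δ) (h : (1 - δ) * defectMoment w k ≤ defectMoment w (k + 1)) :
    ∃ z : Fin k → ZMod p, defectMoment w k / 2 ≤ tupleMass z ∧
      ((Finset.univ.filter fun j => w j ∉ tupleSpectrum z).card : ℝ) ≤
        8 * δ * Fintype.card ι := by
  set L : ℝ := (Fintype.card ι : ℝ) with hLdef
  have hL : 0 < L := by rw [hLdef]; exact_mod_cast hι
  let loss : (Fin k → ZMod p) → ℝ := fun z => ∑ t, tupleWeight z t * phaseDefect w t
  have s1 : ∑ I : Fin k → ι, tupleMass (w ∘ I) = L ^ k * defectMoment w k := by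
    unfold tupleMass defectMoment
    rw [Finset.sum_comm, Finset.mul_sum]
    exact Finset.sum_congr rfl fun t _ => sum_tupleWeight_comp w k t hι
  have s2 : ∑ I : Fin k → ι, loss (w ∘ I) =
      L ^ k * (L * (defectMoment w k - defectMoment w (k + 1))) := by
    unfold defectMoment
    simp only [loss]
    rw [Finset.sum_comm, ← Finset.sum_sub_distrib, Finset.mul_sum, Finset.mul_sum]
    refine Finset.sum_congr rfl fun t _ => ?_
    rw [← Finset.sum_mul, sum_tupleWeight_comp w k t hι, ← hLdef, pow_succ]
    field_simp
    ring
  -- Averaging one combined quantity yields a single tuple with both large mass and small loss: the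
  -- mean loss is at most `δ * L` times the mean mass, so the penalty costs at most half of the mean
  -- mass.
  have s3 : ∑ _I : Fin k → ι, defectMoment w k / 2 ≤
      ∑ I : Fin k → ι, (tupleMass (w ∘ I) - loss (w ∘ I) / (2 * δ * L)) := by
    rw [Finset.sum_sub_distrib, ← Finset.sum_div _ fun I : Fin k → ι => loss (w ∘ I), s1, s2]
    simp only [Finset.sum_const, Finset.card_univ, Fintype.card_fun, Fintype.card_fin, nsmul_eq_mul,
      Nat.cast_pow]
    have e : L ^ k * (L * (defectMoment w k - defectMoment w (k + 1))) / (2 * δ * L) =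
        L ^ k * ((defectMoment w k - defectMoment w (k + 1)) / (2 * δ)) := by
      field_simp
    rw [e, ← hLdef, ← mul_sub]
    refine mul_le_mul_of_nonneg_left ?_ (by positivity)
    have : (defectMoment w k - defectMoment w (k + 1)) / (2 * δ) ≤ defectMoment w k / 2 := by
      rw [div_le_iff₀ (by positivity)]
      linarith
    linarith
  have : Nonempty ι := Fintype.card_pos_iff.1 hι
  obtain ⟨I, -, hI⟩ := Finset.exists_le_of_sum_le Finset.univ_nonempty s3
  have hloss0 : 0 ≤ loss (w ∘ I) := Finset.sum_nonneg fun t _ =>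
    mul_nonneg (tupleWeight_nonneg _ t) (phaseDefect_nonneg w t)
  have hq : 0 ≤ loss (w ∘ I) / (2 * δ * L) := by positivity
  have hmom := one_le_defectMoment w k
  refine ⟨w ∘ I, by linarith, ?_⟩
  have hm := one_le_tupleMass (w ∘ I)
  have hloss : loss (w ∘ I) ≤ 2 * δ * L * tupleMass (w ∘ I) := by
    have : loss (w ∘ I) / (2 * δ * L) ≤ tupleMass (w ∘ I) := by linarith
    rw [div_le_iff₀ (by positivity)] at this
    linarith
  -- Every entry outside the spectrum contributes more than a quarter of the mass to the loss.
  have hO : ((Finset.univ.filter fun j => w j ∉ tupleSpectrum (w ∘ I)).card : ℝ) *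
      (tupleMass (w ∘ I) / 4) ≤ loss (w ∘ I) := by
    have e : loss (w ∘ I) =
        ∑ j, ∑ t, tupleWeight (w ∘ I) t * ((1 - cosChar (t * w j)) / 2) := by
      rw [Finset.sum_comm]
      exact Finset.sum_congr rfl fun t _ => by rw [phaseDefect, Finset.mul_sum]
    rw [e, ← nsmul_eq_mul, ← Finset.sum_const]
    refine (Finset.sum_le_sum fun j hj => ?_).trans
      (Finset.sum_le_sum_of_subset_of_nonneg (Finset.filter_subset _ _) fun j _ _ =>
        Finset.sum_nonneg fun t _ => mul_nonneg (tupleWeight_nonneg _ t)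
          (by linarith [cosChar_le_one (t * w j)]))
    have := (Finset.mem_filter.1 hj).2
    simp only [tupleSpectrum, Finset.mem_filter, Finset.mem_univ, true_and, not_le] at this
    exact this.le
  have : ((Finset.univ.filter fun j => w j ∉ tupleSpectrum (w ∘ I)).card : ℝ) *
      tupleMass (w ∘ I) ≤ (8 * δ * L) * tupleMass (w ∘ I) := by linarith
  exact le_of_mul_le_mul_right this (by linarith)

/-- A vector is compressible if a short tuple captures almost all of its entries in a spectrum that
is small compared with `expSum`. -/
def IsCompressible (K : ℕ) (w : ι → ZMod p) : Prop :=
  ∃ k < K, ∃ z : Fin k → ZMod p,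
    (16 * expSum w) ^ Fintype.card ι *
      (p : ℝ) ^ (k + (Finset.univ.filter fun j => w j ∉ tupleSpectrum z).card) ≤
        tupleMass z ^ Fintype.card ι

-- With the tuple and the exceptional set fixed, entries in `O` are free and the others lie in the
-- spectrum, of size at most `4p / tupleMass z`. Compressibility bounds `expSum w` by `tupleMass z /
-- 16`, up to a factor that pays for `p ^ (k + O.card)`; each coordinate thus gains `4/16`.
open Classical in
theorem sum_compressible_aux (z : Fin k → ZMod p) (O : Finset ι) :
    ∑ w : ι → ZMod p with (Finset.univ.filter fun j => w j ∉ tupleSpectrum z) = O ∧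
        (16 * expSum w) ^ Fintype.card ι * (p : ℝ) ^ (k + O.card) ≤ tupleMass z ^ Fintype.card ι,
      (expSum w / p) ^ Fintype.card ι ≤ (1 / 4) ^ Fintype.card ι * ((p : ℝ) ^ k)⁻¹ := by
  have hp : (0 : ℝ) < p := by exact_mod_cast (Fact.out : p.Prime).pos
  have hm := one_le_tupleMass z
  have hmp := tupleMass_le z
  set L := Fintype.card ι
  set S := Finset.univ.filter fun w : ι → ZMod p =>
    (Finset.univ.filter fun j => w j ∉ tupleSpectrum z) = O ∧
      (16 * expSum w) ^ L * (p : ℝ) ^ (k + O.card) ≤ tupleMass z ^ L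
  have hcard : (S.card : ℝ) ≤ (p : ℝ) ^ O.card * (4 * p / tupleMass z) ^ L := by
    have hsub : S ⊆ Fintype.piFinset fun j => if j ∈ O then Finset.univ else tupleSpectrum z := by
      intro w hw
      have hw' := (Finset.mem_filter.1 hw).2.1
      rw [Fintype.mem_piFinset]
      intro j
      split_ifs with hj
      · exact Finset.mem_univ _
      · by_contra hc
        exact hj (hw' ▸ Finset.mem_filter.2 ⟨Finset.mem_univ _, hc⟩)
    have h1 := Finset.card_le_card hsub
    rw [Fintype.card_piFinset] at h1
    have h2 : ∏ j, (if j ∈ O then Finset.univ else tupleSpectrum z).card =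
        p ^ O.card * (tupleSpectrum z).card ^ (Finset.univ \ O).card := by
      rw [← Finset.prod_sdiff (Finset.subset_univ O), mul_comm]
      congr 1
      · rw [Finset.prod_congr rfl fun j hj => by rw [if_pos hj]]
        simp [ZMod.card]
      · rw [Finset.prod_congr rfl fun j hj => by rw [if_neg (Finset.mem_sdiff.1 hj).2]]
        simp
    rw [h2] at h1
    have h3 : (S.card : ℝ) ≤
        (p : ℝ) ^ O.card * ((tupleSpectrum z).card : ℝ) ^ (Finset.univ \ O).card := by
      exact_mod_cast h1
    refine h3.trans (mul_le_mul_of_nonneg_left ?_ (by positivity))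
    have h4 : ((tupleSpectrum z).card : ℝ) ≤ 4 * p / tupleMass z := by
      rw [le_div_iff₀ (by linarith)]
      exact card_tupleSpectrum_mul_le z
    -- The mass is at most `p`, so `4p / tupleMass z ≥ 1` and the exponent may be raised to `L`.
    refine (pow_le_pow_left₀ (by positivity) h4 _).trans (pow_le_pow_right₀ ?_ ?_)
    · rw [le_div_iff₀ (by linarith)]
      linarith
    · exact (Finset.card_le_card (Finset.subset_univ _)).trans_eq Finset.card_univ
  have hterm : ∀ w ∈ S, (expSum w / p) ^ L ≤
      (tupleMass z / (16 * p)) ^ L * ((p : ℝ) ^ (k + O.card))⁻¹ := by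
    intro w hw
    have hw' := (Finset.mem_filter.1 hw).2.2
    rw [le_mul_inv_iff₀ (by positivity), div_pow, div_pow, div_mul_eq_mul_div,
      div_le_div_iff₀ (by positivity) (by positivity)]
    calc expSum w ^ L * (p : ℝ) ^ (k + O.card) * (16 * p) ^ L
        = ((16 * expSum w) ^ L * (p : ℝ) ^ (k + O.card)) * p ^ L := by
          rw [mul_pow, mul_pow]; ring
      _ ≤ _ := mul_le_mul_of_nonneg_right hw' (by positivity)
  calc ∑ w ∈ S, (expSum w / p) ^ L
      ≤ S.card • ((tupleMass z / (16 * p)) ^ L * ((p : ℝ) ^ (k + O.card))⁻¹) :=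
        Finset.sum_le_card_nsmul _ _ _ hterm
    _ ≤ ((p : ℝ) ^ O.card * (4 * p / tupleMass z) ^ L) *
          ((tupleMass z / (16 * p)) ^ L * ((p : ℝ) ^ (k + O.card))⁻¹) := by
        rw [nsmul_eq_mul]
        have : 0 ≤ tupleMass z := by linarith
        exact mul_le_mul_of_nonneg_right hcard (by positivity)
    _ = _ := by
        have hm0 : tupleMass z ≠ 0 := by linarith
        have e : (4 * p / tupleMass z) * (tupleMass z / (16 * p)) = 1 / 4 := by
          field_simp
          norm_num
        rw [← e, mul_pow, pow_add]
        field_simp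

-- A union bound over `p ^ k` tuples and `2 ^ L` exceptional sets turns `4⁻ᴸ p⁻ᵏ` into `2⁻ᴸ` for
-- each `k < K`.
open Classical in
theorem sum_compressible (K : ℕ) :
    ∑ w : ι → ZMod p with IsCompressible K w, (expSum w / p) ^ Fintype.card ι ≤
      K * (1 / 2) ^ Fintype.card ι := by
  have hp : (0 : ℝ) < p := by exact_mod_cast (Fact.out : p.Prime).pos
  set L := Fintype.card ι
  let S : (k : ℕ) → (Fin k → ZMod p) → Finset ι → Finset (ι → ZMod p) := fun k z O =>
    Finset.univ.filter fun w =>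
      (Finset.univ.filter fun j => w j ∉ tupleSpectrum z) = O ∧
      (16 * expSum w) ^ L * (p : ℝ) ^ (k + O.card) ≤ tupleMass z ^ L
  have hX : ∀ w : ι → ZMod p, 0 ≤ (expSum w / p) ^ L := fun w => by
    have := one_le_expSum w
    positivity
  have hsub : (Finset.univ.filter fun w : ι → ZMod p => IsCompressible K w) ⊆
      (Finset.range K).biUnion fun k => Finset.univ.biUnion fun z : Fin k → ZMod p =>
        Finset.univ.biUnion fun O => S k z O := by
    intro w hw
    obtain ⟨k, hk, z, hz⟩ := (Finset.mem_filter.1 hw).2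
    simp only [Finset.mem_biUnion, Finset.mem_range, Finset.mem_univ, true_and]
    exact ⟨k, hk, z, _, Finset.mem_filter.2 ⟨Finset.mem_univ _, rfl, hz⟩⟩
  calc ∑ w : ι → ZMod p with IsCompressible K w, (expSum w / p) ^ L
      ≤ ∑ w ∈ (Finset.range K).biUnion fun k => Finset.univ.biUnion fun z : Fin k → ZMod p =>
        Finset.univ.biUnion fun O => S k z O, (expSum w / p) ^ L :=
        Finset.sum_le_sum_of_subset_of_nonneg hsub fun w _ _ => hX w
    _ ≤ ∑ k ∈ Finset.range K, ∑ w ∈ Finset.univ.biUnion fun z : Fin k → ZMod p =>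
        Finset.univ.biUnion fun O => S k z O, (expSum w / p) ^ L := sum_biUnion_le_sum_sum hX _ _
    _ ≤ ∑ k ∈ Finset.range K, (1 / 2 : ℝ) ^ L := by
        refine Finset.sum_le_sum fun k _ => ?_
        calc _ ≤ ∑ z : Fin k → ZMod p, ∑ w ∈ Finset.univ.biUnion fun O => S k z O,
              (expSum w / p) ^ L := sum_biUnion_le_sum_sum hX _ _
          _ ≤ ∑ z : Fin k → ZMod p, ∑ O : Finset ι, ∑ w ∈ S k z O, (expSum w / p) ^ L :=
              Finset.sum_le_sum fun z _ => sum_biUnion_le_sum_sum hX _ _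
          _ ≤ ∑ z : Fin k → ZMod p, ∑ O : Finset ι, (1 / 4) ^ L * ((p : ℝ) ^ k)⁻¹ :=
              Finset.sum_le_sum fun z _ => Finset.sum_le_sum fun O _ => sum_compressible_aux z O
          _ = (1 / 2 : ℝ) ^ L := by
              simp only [Finset.sum_const, Finset.card_univ, Fintype.card_finset, Fintype.card_fun,
                Fintype.card_fin, ZMod.card, nsmul_eq_mul, Nat.cast_pow, Nat.cast_ofNat]
              have : (1 / 2 : ℝ) = 2 * (1 / 4) := by norm_num
              rw [this, mul_pow]
              field_simp
              rfl
    _ = _ := by simp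

end Tuples

/-! ### Level sets of the phase defect and their doubling -/

section LevelSets

variable {p : ℕ} [Fact p.Prime] {ι : Type*} [Fintype ι]

noncomputable def levelSet (w : ι → ZMod p) (x : ℝ) : Finset (ZMod p) :=
  Finset.univ.filter fun t => phaseDefect w t ≤ x

theorem mem_levelSet {w : ι → ZMod p} {x : ℝ} {t : ZMod p} :
    t ∈ levelSet w x ↔ phaseDefect w t ≤ x := by simp [levelSet]

theorem levelSet_mono (w : ι → ZMod p) {x y : ℝ} (h : x ≤ y) : levelSet w x ⊆ levelSet w y :=
  fun _ ht => mem_levelSet.2 ((mem_levelSet.1 ht).trans h)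

theorem one_le_card_levelSet (w : ι → ZMod p) {x : ℝ} (hx : 0 ≤ x) : 1 ≤ (levelSet w x).card :=
  Finset.card_pos.2 ⟨0, mem_levelSet.2 (by simpa using hx)⟩

-- The sumset of a level set with itself lies at level `4 * x`, and Cauchy-Davenport gives it at
-- least `2 * card - 1` elements unless it is everything.
open Pointwise in
theorem two_mul_card_levelSet_le (w : ι → ZMod p) {x : ℝ} (hx : 0 ≤ x)
    (h : levelSet w (4 * x) ≠ Finset.univ) :
    2 * (levelSet w x).card ≤ (levelSet w (4 * x)).card + 1 := by
  have hne : (levelSet w x).Nonempty := Finset.card_pos.1 (one_le_card_levelSet w hx)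
  have hcd := ZMod.cauchy_davenport (Fact.out : p.Prime) hne hne
  have hsub : levelSet w x + levelSet w x ⊆ levelSet w (4 * x) := by
    intro t ht
    obtain ⟨a, ha, b, hb, rfl⟩ := Finset.mem_add.1 ht
    rw [mem_levelSet] at *
    linarith [phaseDefect_add_le w a b]
  have hle := Finset.card_le_card hsub
  have hlt : (levelSet w (4 * x)).card < p := by
    have := Finset.card_lt_card ((Finset.subset_univ _).ssubset_of_ne h)
    simpa [ZMod.card] using this
  omega

theorem two_pow_mul_card_levelSet_le (w : ι → ZMod p) {x : ℝ} (hx : 0 ≤ x)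
    (h : levelSet w x ≠ Finset.univ) (i : ℕ) :
    (2 : ℝ) ^ i * ((levelSet w (x / 4 ^ i)).card - 1) ≤ (levelSet w x).card - 1 := by
  induction i with
  | zero => simp
  | succ i ih =>
    have e : 4 * (x / 4 ^ (i + 1)) = x / 4 ^ i := by rw [pow_succ]; field_simp
    have hne : levelSet w (4 * (x / 4 ^ (i + 1))) ≠ Finset.univ := by
      intro hu
      refine h (Finset.eq_univ_of_forall fun t => ?_)
      have ht : t ∈ levelSet w (4 * (x / 4 ^ (i + 1))) := hu ▸ Finset.mem_univ t
      refine levelSet_mono w ?_ ht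
      rw [e]
      exact div_le_self hx (one_le_pow₀ (by norm_num))
    have h2 := two_mul_card_levelSet_le w (by positivity : 0 ≤ x / 4 ^ (i + 1)) hne
    rw [e] at h2
    have h3 : 2 * ((levelSet w (x / 4 ^ (i + 1))).card : ℝ) ≤ (levelSet w (x / 4 ^ i)).card + 1 := by
      exact_mod_cast h2
    calc (2 : ℝ) ^ (i + 1) * ((levelSet w (x / 4 ^ (i + 1))).card - 1)
        = 2 ^ i * (2 * ((levelSet w (x / 4 ^ (i + 1))).card : ℝ) - 2) := by rw [pow_succ]; ring
      _ ≤ 2 ^ i * ((levelSet w (x / 4 ^ i)).card - 1) :=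
          mul_le_mul_of_nonneg_left (by linarith) (by positivity)
      _ ≤ _ := ih

/-- The mean of the phase defect over all `t` is half the support size, so some `t` lies above any
smaller level. -/
theorem levelSet_ne_univ {w : ι → ZMod p} {x : ℝ}
    (h : x < ((Finset.univ.filter fun j => w j ≠ 0).card : ℝ) / 2) :
    levelSet w x ≠ Finset.univ := by
  intro hu
  have hp : (0 : ℝ) < p := by exact_mod_cast (Fact.out : p.Prime).pos
  have h1 : ∑ t, phaseDefect w t ≤ ∑ _t : ZMod p, x :=
    Finset.sum_le_sum fun t _ => mem_levelSet.1 (hu ▸ Finset.mem_univ t)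
  rw [sum_phaseDefect, Finset.sum_const, Finset.card_univ, ZMod.card, nsmul_eq_mul] at h1
  nlinarith

/-- Split the frequencies at defects `a` and `x`, bounding the exponential on the three ranges by
`1`, `exp (-a / 2)` and `exp (-x / 2)`. -/
theorem expSum_le_levelSet (w : ι → ZMod p) (a x : ℝ) :
    expSum w ≤ (levelSet w a).card + (levelSet w x).card * Real.exp (-(a / 2)) +
      p * Real.exp (-(x / 2)) := by
  have key : ∀ t, Real.exp (-(phaseDefect w t / 2)) ≤ (if phaseDefect w t ≤ a then 1 else 0) +
      (if phaseDefect w t ≤ x then Real.exp (-(a / 2)) else 0) + Real.exp (-(x / 2)) := by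
    intro t
    have h1 : Real.exp (-(phaseDefect w t / 2)) ≤ 1 :=
      Real.exp_le_one_iff.2 (by linarith [phaseDefect_nonneg w t])
    have ha := (Real.exp_pos (-(a / 2))).le
    have hx := (Real.exp_pos (-(x / 2))).le
    by_cases h2 : phaseDefect w t ≤ a
    · rw [if_pos h2]
      split_ifs <;> linarith
    · rw [if_neg h2]
      have h3 : Real.exp (-(phaseDefect w t / 2)) ≤ Real.exp (-(a / 2)) :=
        Real.exp_le_exp.2 (by linarith)
      by_cases h4 : phaseDefect w t ≤ x
      · rw [if_pos h4]; linarith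
      · rw [if_neg h4]
        have h5 : Real.exp (-(phaseDefect w t / 2)) ≤ Real.exp (-(x / 2)) :=
          Real.exp_le_exp.2 (by linarith)
        linarith
  refine (Finset.sum_le_sum fun t _ => key t).trans (le_of_eq ?_)
  rw [Finset.sum_add_distrib, Finset.sum_add_distrib, ← Finset.sum_filter, ← Finset.sum_filter]
  simp [levelSet, ZMod.card]

theorem card_levelSet_mul_le_defectMoment (w : ι → ZMod p) {x : ℝ} (hx : x ≤ Fintype.card ι)
    (K : ℕ) :
    (levelSet w x).card * (1 - x / Fintype.card ι) ^ K ≤ defectMoment w K := by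
  rw [← nsmul_eq_mul, ← Finset.sum_const]
  refine (Finset.sum_le_sum fun t ht => ?_).trans
    (Finset.sum_le_sum_of_subset_of_nonneg (Finset.subset_univ _) fun t _ _ =>
      pow_nonneg (one_sub_phaseDefect_nonneg w t) K)
  refine pow_le_pow_left₀ (sub_nonneg.2 (div_le_one_of_le₀ hx (by positivity))) ?_ K
  have := mem_levelSet.1 ht
  gcongr

end LevelSets

/-! ### Decay of moments for incompressible vectors -/

section Incompressible

variable {p : ℕ} [Fact p.Prime] {ι : Type*} [Fintype ι]

/-- The tuple supplied by `exists_tuple_of_defectMoment` must violate the compressibility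
inequality; take logarithms and divide by `L`. The 32 is 16 from compressibility times 2 from the
halved mass. -/
theorem log_defectMoment_lt_of_not_isCompressible {K : ℕ} {w : ι → ZMod p}
    (hw : ¬ IsCompressible K w) (hι : 0 < Fintype.card ι) {k : ℕ} (hk : k < K) :
    Real.log (defectMoment w k) < Real.log 32 + Real.log (expSum w) +
      (K + 8) * Real.log p / Fintype.card ι +
      8 * Real.log p * (Real.log (defectMoment w k) - Real.log (defectMoment w (k + 1))) := by
  have hp1 : (1 : ℝ) < p := by exact_mod_cast (Fact.out : p.Prime).one_lt
  have hlp : 0 < Real.log p := Real.log_pos hp1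
  have hQ := one_le_defectMoment w k
  have hQ' := one_le_defectMoment w (k + 1)
  have hF := one_le_expSum w
  have hL : (0 : ℝ) < Fintype.card ι := by exact_mod_cast hι
  set L := Fintype.card ι
  -- The extra `1 / L` keeps `δ` positive when the moments coincide; it costs 8 more exceptional
  -- entries, hence `K + 8`.
  set δ : ℝ := 1 - defectMoment w (k + 1) / defectMoment w k + 1 / L with hδ
  have hr : defectMoment w (k + 1) / defectMoment w k ≤ 1 :=
    div_le_one_of_le₀ (defectMoment_succ_le w k) (by linarith)
  have hδ0 : 0 < δ := by
    have : 0 < 1 / (L : ℝ) := by positivity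
    linarith
  obtain ⟨z, hz1, hz2⟩ := exists_tuple_of_defectMoment w k hι hδ0 (by
    have e : defectMoment w (k + 1) =
        defectMoment w (k + 1) / defectMoment w k * defectMoment w k := by field_simp
    have : (1 - δ) ≤ defectMoment w (k + 1) / defectMoment w k := by
      have : 0 < 1 / (L : ℝ) := by positivity
      linarith
    calc (1 - δ) * defectMoment w k
        ≤ defectMoment w (k + 1) / defectMoment w k * defectMoment w k :=
          mul_le_mul_of_nonneg_right this (by linarith)
      _ = _ := e.symm)
  set r := (Finset.univ.filter fun j => w j ∉ tupleSpectrum z).card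
  have hnot : tupleMass z ^ L < (16 * expSum w) ^ L * (p : ℝ) ^ (k + r) := by
    by_contra hc
    exact hw ⟨k, hk, z, not_lt.1 hc⟩
  have h1 : (defectMoment w k / 2) ^ L < (16 * expSum w) ^ L * (p : ℝ) ^ (k + r) :=
    (pow_le_pow_left₀ (by linarith) hz1 L).trans_lt hnot
  have h2 := Real.log_lt_log (by positivity) h1
  rw [Real.log_mul (by positivity) (by positivity), Real.log_pow, Real.log_pow, Real.log_pow,
    Real.log_div (by linarith) (by norm_num), Real.log_mul (by norm_num) (by linarith)] at h2
  have h32 : Real.log 32 = Real.log 16 + Real.log 2 := by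
    rw [← Real.log_mul (by norm_num) (by norm_num)]; norm_num
  have hdiff : 1 - defectMoment w (k + 1) / defectMoment w k ≤
      Real.log (defectMoment w k) - Real.log (defectMoment w (k + 1)) := by
    have := Real.log_le_sub_one_of_pos
      (by positivity : 0 < defectMoment w (k + 1) / defectMoment w k)
    rw [Real.log_div (by linarith) (by linarith)] at this
    linarith
  have hkr : ((k + r : ℕ) : ℝ) ≤
      K + 8 + 8 * (Real.log (defectMoment w k) - Real.log (defectMoment w (k + 1))) * L := by
    have hk' : (k : ℝ) ≤ K := by exact_mod_cast hk.le
    have e : 8 * δ * L = 8 * (1 - defectMoment w (k + 1) / defectMoment w k) * L + 8 := by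
      rw [hδ]; field_simp
    have := mul_le_mul_of_nonneg_right hdiff hL.le
    push_cast
    linarith
  have h3 := mul_le_mul_of_nonneg_right hkr hlp.le
  have h4 : (L : ℝ) * Real.log (defectMoment w k) < L * (Real.log 32 + Real.log (expSum w) +
      (K + 8) * Real.log p / L +
      8 * Real.log p * (Real.log (defectMoment w k) - Real.log (defectMoment w (k + 1)))) := by
    have e : (L : ℝ) * ((K + 8) * Real.log p / L) = (K + 8) * Real.log p := by field_simp
    rw [mul_add, mul_add (L : ℝ) _ ((K + 8) * Real.log p / L), e, h32]
    linarith
  exact lt_of_mul_lt_mul_left h4 hL.le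

/-- The preceding inequality says that the excess of `log Q_k` over `log F + c` is at most `A` times
its next decrement, so it contracts by `1 - 1 / A` at each step, starting from at most `log p`. -/
theorem defectMoment_le_of_not_isCompressible {K : ℕ} {w : ι → ZMod p}
    (hw : ¬ IsCompressible K w) (hι : 0 < Fintype.card ι) {A : ℝ} (hA : 1 ≤ A)
    (hpA : 8 * Real.log p ≤ A) :
    defectMoment w K ≤ expSum w * Real.exp (Real.log 32 +
      (K + 8) * Real.log p / Fintype.card ι + Real.log p * Real.exp (-(K / A))) := by
  have hp1 : (1 : ℝ) < p := by exact_mod_cast (Fact.out : p.Prime).one_lt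
  have hlp : 0 < Real.log p := Real.log_pos hp1
  have hF := one_le_expSum w
  have hL : (0 : ℝ) < Fintype.card ι := by exact_mod_cast hι
  set c : ℝ := Real.log 32 + (K + 8) * Real.log p / Fintype.card ι with hc
  have hc0 : 0 ≤ c := add_nonneg (Real.log_nonneg (by norm_num)) (by positivity)
  have key : ∀ k ≤ K, Real.log (defectMoment w k) - Real.log (expSum w) - c ≤
      (1 - 1 / A) ^ k * Real.log p := by
    intro k
    induction k with
    | zero =>
      intro _
      rw [defectMoment_zero, pow_zero, one_mul]
      linarith [Real.log_nonneg hF]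
    | succ k ih =>
      intro hk
      have h1 := ih (by omega)
      have h2 := log_defectMoment_lt_of_not_isCompressible hw hι (k := k) (by omega)
      have hmono : 0 ≤ Real.log (defectMoment w k) - Real.log (defectMoment w (k + 1)) :=
        sub_nonneg.2 (Real.log_le_log (by linarith [one_le_defectMoment w (k + 1)])
          (defectMoment_succ_le w k))
      have h3 := mul_le_mul_of_nonneg_right hpA hmono
      have hA' : 0 ≤ 1 - 1 / A := sub_nonneg.2 (div_le_one_of_le₀ hA (by linarith))
      have h4 : Real.log (defectMoment w (k + 1)) - Real.log (expSum w) - c ≤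
          (1 - 1 / A) * (Real.log (defectMoment w k) - Real.log (expSum w) - c) := by
        have h5 : Real.log (defectMoment w k) - Real.log (expSum w) - c ≤
            A * (Real.log (defectMoment w k) - Real.log (defectMoment w (k + 1))) := by linarith
        have h6 : (Real.log (defectMoment w k) - Real.log (expSum w) - c) / A ≤
            Real.log (defectMoment w k) - Real.log (defectMoment w (k + 1)) := by
          rw [div_le_iff₀ (by linarith)]; linarith
        have e : (1 - 1 / A) * (Real.log (defectMoment w k) - Real.log (expSum w) - c) =
            (Real.log (defectMoment w k) - Real.log (expSum w) - c) -
            (Real.log (defectMoment w k) - Real.log (expSum w) - c) / A := by ring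
        rw [e]
        linarith
      calc _ ≤ _ := h4
        _ ≤ (1 - 1 / A) * ((1 - 1 / A) ^ k * Real.log p) := mul_le_mul_of_nonneg_left h1 hA'
        _ = _ := by rw [pow_succ]; ring
  have h1 := key K le_rfl
  have h2 : (1 - 1 / A) ^ K ≤ Real.exp (-(K / A)) := by
    have : (1 - 1 / A) ≤ Real.exp (-(1 / A)) := by
      have := Real.add_one_le_exp (-(1 / A)); linarith
    calc (1 - 1 / A) ^ K ≤ Real.exp (-(1 / A)) ^ K :=
          pow_le_pow_left₀ (sub_nonneg.2 (div_le_one_of_le₀ hA (by linarith))) this K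
      _ = _ := by rw [← Real.exp_nat_mul]; congr 1; ring
  have h3 : Real.log (defectMoment w K) ≤
      Real.log (expSum w) + (c + Real.log p * Real.exp (-(K / A))) := by
    have := mul_le_mul_of_nonneg_right h2 hlp.le
    linarith
  have hQ := one_le_defectMoment w K
  rw [← Real.exp_log (by linarith : 0 < defectMoment w K)]
  refine (Real.exp_le_exp.2 h3).trans (le_of_eq ?_)
  rw [Real.exp_add, Real.exp_log (by linarith)]

end Incompressible

/-! ### Choice of parameters; incompressible vectors have small exponential sum -/

theorem cube_div_six_le_exp {x : ℝ} (hx : 0 ≤ x) : x ^ 3 / 6 ≤ Real.exp x := by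
  have := Real.pow_div_factorial_le_exp x hx 3
  simpa [Nat.factorial] using this

theorem sqrt_eq_exp_log_div_two {L : ℝ} (hL : 0 < L) : √L = Real.exp (Real.log L / 2) := by
  rw [Real.sqrt_eq_iff_mul_self_eq hL.le (Real.exp_pos _).le, ← Real.exp_add, add_halves,
    Real.exp_log hL]

theorem log_le_sqrt_div {L : ℝ} (hL : 0 < L) (hlog : 128 ≤ Real.log L) :
    64 * Real.log L ≤ √L := by
  have h := cube_div_six_le_exp (by linarith : 0 ≤ Real.log L / 2)
  rw [sqrt_eq_exp_log_div_two hL]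
  nlinarith [mul_nonneg (by linarith : 0 ≤ Real.log L) (by linarith : 0 ≤ Real.log L - 128),
    mul_nonneg (mul_nonneg (by linarith : 0 ≤ Real.log L) (by linarith : 0 ≤ Real.log L - 128))
      (by linarith : 0 ≤ Real.log L + 128)]

/-- The number of moments used in the dichotomy between compressible and spread-out vectors. -/
noncomputable def momentOrder (L : ℝ) : ℕ := ⌈√L * Real.log L / 8⌉₊

theorem momentOrder_le {L : ℝ} (hlog : 128 ≤ Real.log L) :
    (momentOrder L : ℝ) ≤ √L * Real.log L / 8 + 1 :=
  (Nat.ceil_lt_add_one (by positivity)).le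

section

variable {p : ℕ} [Fact p.Prime] {ι : Type*} [Fintype ι]

/-- With `A = √L / 8` and `K ≈ A * log L`, the decay term is negligible and `Q_K` is at most `F`
times a small power of `L`. On the level set every summand of `Q_K` is at least `(1 - 1 / (16√L)) ^
K`, which costs only another small power. -/
theorem card_levelSet_le_of_not_isCompressible {w : ι → ZMod p} {L : ℝ}
    (hcard : (Fintype.card ι : ℝ) = L) (hL : 0 < L) (hlog : 128 ≤ Real.log L)
    (hp : Real.log p ≤ √L / 64) (hw : ¬ IsCompressible (momentOrder L) w) :
    ((levelSet w (√L / 16)).card : ℝ) ≤ expSum w * Real.exp (9 + Real.log L / 32) := by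
  set R := √L with hR
  set l := Real.log L with hl
  set K := momentOrder L with hK
  have hRl : 64 * l ≤ R := log_le_sqrt_div hL hlog
  have hRR : R * R = L := Real.mul_self_sqrt hL.le
  have hR0 : 0 < R := by linarith
  have hF := one_le_expSum w
  have hι : 0 < Fintype.card ι := by
    have : (0 : ℝ) < Fintype.card ι := by rw [hcard]; exact hL
    exact_mod_cast this
  have hKle : (K : ℝ) ≤ R * l / 8 + 1 := momentOrder_le hlog
  have hKge : R * l / 8 ≤ K := Nat.le_ceil _
  have hlp : 0 ≤ Real.log p := Real.log_natCast_nonneg p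
  have h1 := defectMoment_le_of_not_isCompressible hw hι (A := R / 8) (by linarith) (by linarith)
  rw [hcard] at h1
  have h2 := card_levelSet_mul_le_defectMoment w (x := R / 16) (by rw [hcard]; nlinarith) K
  rw [hcard] at h2
  have e32 : Real.log 32 ≤ 5 := by
    have : (32 : ℝ) = 2 ^ 5 := by norm_num
    rw [this, Real.log_pow]
    have := Real.log_two_lt_d9
    push_cast
    linarith
  have e1 : (K + 8) * Real.log p / L ≤ l / 512 + 1 := by
    rw [div_le_iff₀ hL]
    calc (K + 8) * Real.log p ≤ (R * l / 8 + 1 + 8) * (R / 64) :=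
          mul_le_mul (by linarith) hp hlp (by nlinarith)
      _ = l / 512 * (R * R) + 9 / 64 * R := by ring
      _ ≤ (l / 512 + 1) * L := by rw [hRR]; nlinarith
  have e2 : Real.log p * Real.exp (-(K / (R / 8))) ≤ 1 := by
    have : l ≤ K / (R / 8) := by rw [le_div_iff₀ (by positivity)]; linarith
    have h3 : Real.exp (-(K / (R / 8))) ≤ L⁻¹ := by
      rw [← Real.exp_log hL, ← Real.exp_neg]
      exact Real.exp_le_exp.2 (by linarith)
    calc _ ≤ (R / 64) * L⁻¹ := mul_le_mul hp h3 (Real.exp_pos _).le (by linarith)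
      _ ≤ 1 := by
        rw [mul_inv_le_iff₀ hL]
        nlinarith
  have e3 : Real.exp (-(l / 64 + 1)) ≤ (1 - R / 16 / L) ^ K := by
    have hy : R / 16 / L = 1 / (16 * R) := by rw [← hRR]; field_simp
    rw [hy]
    have hy0 : 0 < 1 / (16 * R) := by positivity
    have hy1 : 1 / (16 * R) ≤ 1 / 2 := by
      rw [div_le_div_iff₀ (by positivity) (by norm_num)]; linarith
    -- The bound `exp (-2y) ≤ 1 - y`, valid for `0 ≤ y ≤ 1/2`.
    have h4 : Real.exp (-(2 * (1 / (16 * R)))) ≤ 1 - 1 / (16 * R) := by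
      generalize 1 / (16 * R) = y at hy0 hy1
      have h5 := Real.add_one_le_exp (2 * y)
      rw [Real.exp_neg, inv_le_iff_one_le_mul₀ (Real.exp_pos _)]
      nlinarith
    calc Real.exp (-(l / 64 + 1)) ≤ Real.exp (-(2 * (1 / (16 * R)))) ^ K := by
          rw [← Real.exp_nat_mul]
          refine Real.exp_le_exp.2 ?_
          have : (K : ℝ) * (1 / (8 * R)) ≤ l / 64 + 1 := by
            rw [mul_one_div, div_le_iff₀ (by positivity)]
            nlinarith
          have e : (K : ℝ) * -(2 * (1 / (16 * R))) = -(K * (1 / (8 * R))) := by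
            field_simp
            ring
          rw [e]
          linarith
      _ ≤ _ := pow_le_pow_left₀ (Real.exp_pos _).le h4 K
  have h3 : ((levelSet w (R / 16)).card : ℝ) * Real.exp (-(l / 64 + 1)) ≤
      expSum w * Real.exp (5 + (l / 512 + 1) + 1) := by
    refine ((mul_le_mul_of_nonneg_left e3 (by positivity)).trans h2).trans (h1.trans ?_)
    refine mul_le_mul_of_nonneg_left (Real.exp_le_exp.2 ?_) (by linarith)
    linarith
  calc ((levelSet w (R / 16)).card : ℝ)
      = (levelSet w (R / 16)).card * Real.exp (-(l / 64 + 1)) * Real.exp (l / 64 + 1) := by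
        rw [mul_assoc, ← Real.exp_add]; simp
    _ ≤ expSum w * Real.exp (5 + (l / 512 + 1) + 1) * Real.exp (l / 64 + 1) :=
        mul_le_mul_of_nonneg_right h3 (Real.exp_pos _).le
    _ ≤ _ := by
        rw [mul_assoc, ← Real.exp_add]
        refine mul_le_mul_of_nonneg_left (Real.exp_le_exp.2 ?_) (by linarith)
        linarith

/-- Descend by doubling from level `√L / 16` to `√L / (16 * 4 ^ i)`. If the lower level set had a
second element, it would have at most `F / 4` elements and the three-range bound would give `F < F`;
so it is `{0}`, and the bound reads `F ≤ 1 + F / (2L) + 1 / L`. -/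
theorem expSum_le_of_not_isCompressible {w : ι → ZMod p} {L : ℝ}
    (hcard : (Fintype.card ι : ℝ) = L) (hL : 0 < L) (hlog : 128 ≤ Real.log L)
    (hp : Real.log p ≤ √L / 64) (hw : ¬ IsCompressible (momentOrder L) w)
    (hsupp : √L / 8 < ((Finset.univ.filter fun j => w j ≠ 0).card : ℝ)) :
    expSum w ≤ 1 + 3 / L := by
  have hT := card_levelSet_le_of_not_isCompressible hcard hL hlog hp hw
  set R := √L with hR
  set l := Real.log L with hl
  set M := Real.exp (9 + l / 32) with hM
  set u := Real.exp (l / 8) with hu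
  have hRl : 64 * l ≤ R := log_le_sqrt_div hL hlog
  have hF := one_le_expSum w
  have hp0 : (0 : ℝ) < p := by exact_mod_cast (Fact.out : p.Prime).pos
  have hLexp : L = Real.exp l := (Real.exp_log hL).symm
  have hL8 : 8 ≤ L := by
    have := Real.add_one_le_exp l
    linarith
  have hRexp : R = Real.exp (l / 2) := sqrt_eq_exp_log_div_two hL
  have hu1 : 1 ≤ u := Real.one_le_exp (by linarith)
  -- So `2 ^ i` is within a factor 2 of `L ^ (1/8)`: large enough to beat the loss `L ^ (1/32)`,
  -- while the final level stays of order at least `L ^ (1/4)`.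
  obtain ⟨i, hi1, hi2⟩ := exists_nat_pow_near hu1 (by norm_num : (1 : ℝ) < 2)
  have hfour : (4 : ℝ) ^ i ≤ Real.exp (l / 4) := by
    have e : (4 : ℝ) ^ i = (2 ^ i) * 2 ^ i := by rw [← mul_pow]; norm_num
    have e2 : Real.exp (l / 4) = u * u := by rw [hu, ← Real.exp_add]; congr 1; ring
    rw [e, e2]
    exact mul_le_mul hi1 hi1 (by positivity) (by positivity)
  have hsum := expSum_le_levelSet w (R / 16 / 4 ^ i) (R / 16)
  have h1 : p * Real.exp (-(R / 16 / 2)) ≤ 1 / L := by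
    rw [one_div, hLexp, ← Real.exp_neg]
    calc p * Real.exp (-(R / 16 / 2)) = Real.exp (Real.log p + -(R / 16 / 2)) := by
          rw [Real.exp_add, Real.exp_log hp0]
      _ ≤ _ := Real.exp_le_exp.2 (by linarith)
  have h2 : M * Real.exp (-(R / 16 / 4 ^ i / 2)) ≤ 1 / (2 * L) := by
    have h3 : Real.exp (l / 4) / 32 ≤ R / 16 / 4 ^ i / 2 := by
      rw [div_div, div_div, div_le_div_iff₀ (by norm_num) (by positivity)]
      have e : R = Real.exp (l / 4) * Real.exp (l / 4) := by
        rw [hRexp, ← Real.exp_add]; congr 1; ring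
      rw [e]
      nlinarith [Real.exp_pos (l / 4)]
    have h4 := cube_div_six_le_exp (by linarith : 0 ≤ l / 4)
    have h5 : 11 + l / 32 + l ≤ Real.exp (l / 4) / 32 := by
      nlinarith [mul_nonneg (by linarith : 0 ≤ l) (by linarith : 0 ≤ l - 128),
        mul_nonneg (mul_nonneg (by linarith : 0 ≤ l) (by linarith : 0 ≤ l - 128))
          (by linarith : 0 ≤ l + 128)]
    have h6 : (2 : ℝ) ≤ Real.exp 1 := by
      have := Real.add_one_le_exp (1 : ℝ); linarith
    calc M * Real.exp (-(R / 16 / 4 ^ i / 2)) ≤ Real.exp (-1 + -l) := by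
          rw [hM, ← Real.exp_add]
          exact Real.exp_le_exp.2 (by linarith)
      _ = (Real.exp 1)⁻¹ * L⁻¹ := by rw [Real.exp_add, Real.exp_neg, Real.exp_neg, ← hLexp]
      _ ≤ 2⁻¹ * L⁻¹ := by gcongr
      _ = _ := by rw [one_div, mul_inv]
  set T := ((levelSet w (R / 16)).card : ℝ) with hTdef
  have h7 : T * Real.exp (-(R / 16 / 4 ^ i / 2)) ≤ expSum w * (1 / (2 * L)) := by
    calc _ ≤ expSum w * M * Real.exp (-(R / 16 / 4 ^ i / 2)) :=
          mul_le_mul_of_nonneg_right hT (Real.exp_pos _).le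
      _ = expSum w * (M * Real.exp (-(R / 16 / 4 ^ i / 2))) := by ring
      _ ≤ _ := mul_le_mul_of_nonneg_left h2 (by linarith)
  have hiL : 1 / (2 * L) = 1 / L / 2 := by rw [div_div, mul_comm]
  have hinv : 0 < 1 / L := by positivity
  have hinv8 : 1 / L ≤ 1 / 8 := one_div_le_one_div_of_le (by norm_num) hL8
  rw [hiL] at h7
  have h3L : 3 / L = 3 * (1 / L) := by ring
  rw [h3L]
  generalize 1 / L = y at *
  have hone := one_le_card_levelSet w (by positivity : 0 ≤ R / 16 / 4 ^ i)
  rcases hone.eq_or_lt with hc | hc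
  · rw [← hc, Nat.cast_one] at hsum
    nlinarith
  · exfalso
    have hc' : (2 : ℝ) ≤ (levelSet w (R / 16 / 4 ^ i)).card := by exact_mod_cast hc
    have hdbl := two_pow_mul_card_levelSet_le w (by positivity : 0 ≤ R / 16)
      (levelSet_ne_univ (by linarith)) i
    set T' := ((levelSet w (R / 16 / 4 ^ i)).card : ℝ)
    -- This needs `12 + l / 32 ≤ l / 8`, that is, exactly `l ≥ 128`.
    have hMu : M * 16 ≤ u := by
      have h16 : (16 : ℝ) ≤ Real.exp 3 := by
        have := cube_div_six_le_exp (by norm_num : (0 : ℝ) ≤ 3)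
        have h := Real.exp_one_gt_d9
        have e : Real.exp 3 = Real.exp 1 * Real.exp 1 * Real.exp 1 := by
          rw [← Real.exp_add, ← Real.exp_add]; norm_num
        rw [e]
        nlinarith [mul_self_nonneg (Real.exp 1 - 2.7)]
      calc M * 16 ≤ M * Real.exp 3 := mul_le_mul_of_nonneg_left h16 (Real.exp_pos _).le
        _ ≤ u := by
          rw [hM, ← Real.exp_add]
          exact Real.exp_le_exp.2 (by linarith)
    have hT' : T' ≤ expSum w / 4 := by
      -- Doubling controls `T' - 1`; since `T' ≥ 2`, passing to `T'` costs only a factor 2.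
      have h8 : u * T' ≤ 4 * T := by
        rw [pow_succ] at hi2
        calc u * T' ≤ u * (2 * (T' - 1)) :=
              mul_le_mul_of_nonneg_left (by linarith) (by linarith)
          _ ≤ (2 ^ i * 2) * (2 * (T' - 1)) :=
              mul_le_mul_of_nonneg_right hi2.le (by linarith)
          _ = 4 * (2 ^ i * (T' - 1)) := by ring
          _ ≤ 4 * T := by linarith
      have h9 : u * T' ≤ u * (expSum w / 4) := by
        calc u * T' ≤ 4 * (expSum w * M) := by linarith
          _ = expSum w * (M * 16) / 4 := by ring
          _ ≤ expSum w * u / 4 := by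
              have := mul_le_mul_of_nonneg_left hMu (by linarith : 0 ≤ expSum w)
              linarith
          _ = _ := by ring
      exact le_of_mul_le_mul_left h9 (by linarith)
    have := mul_le_mul_of_nonneg_left hinv8 (by linarith : 0 ≤ expSum w)
    linarith

end

/-! ### The sum over all vectors on one block -/

section

variable {p : ℕ} [Fact p.Prime] {ι : Type*} [Fintype ι]

open Classical in
theorem sum_pow_card_support (x : ℝ) :
    ∑ w : ι → ZMod p, x ^ (Finset.univ.filter fun j => w j ≠ 0).card =
      (1 + (p - 1) * x) ^ Fintype.card ι := by
  have h := Finset.prod_univ_sum (fun _ : ι => (Finset.univ : Finset (ZMod p)))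
    (fun _ a => if a ≠ 0 then x else 1)
  rw [Fintype.piFinset_univ] at h
  have e : ∑ a : ZMod p, (if a ≠ 0 then x else 1) = 1 + (p - 1) * x := by
    rw [← Finset.add_sum_erase _ _ (Finset.mem_univ (0 : ZMod p)),
      Finset.sum_congr rfl fun a ha => if_pos (Finset.ne_of_mem_erase ha)]
    have : 1 ≤ p := (Fact.out : p.Prime).one_lt.le
    simp [ZMod.card, Finset.card_erase_of_mem, this]
  rw [e, Finset.prod_const, Finset.card_univ] at h
  rw [h]
  refine Finset.sum_congr rfl fun w _ => ?_
  rw [Finset.prod_ite]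
  simp

-- Exponential Markov: weight each support element by `1 / (p * L)`, for which the generating
-- function is at most `(1 + 1 / L) ^ L ≤ e`.
open Classical in
theorem card_sparse_le {s : ℝ} (hι : 0 < Fintype.card ι) :
    ((Finset.univ.filter fun w : ι → ZMod p =>
      ((Finset.univ.filter fun j => w j ≠ 0).card : ℝ) ≤ s).card : ℝ) ≤
      Real.exp (1 + s * (Real.log p + Real.log (Fintype.card ι))) := by
  have hp : (0 : ℝ) < p := by exact_mod_cast (Fact.out : p.Prime).pos
  have hL : (0 : ℝ) < Fintype.card ι := by exact_mod_cast hι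
  set L := Fintype.card ι
  set y := Real.log p + Real.log L with hy
  have hy0 : 0 ≤ y := add_nonneg (Real.log_natCast_nonneg _) (Real.log_natCast_nonneg _)
  have hx : Real.exp (-y) = 1 / (p * L) := by
    rw [Real.exp_neg, hy, Real.exp_add, Real.exp_log hp, Real.exp_log hL, one_div]
  set S := Finset.univ.filter fun w : ι → ZMod p =>
      ((Finset.univ.filter fun j => w j ≠ 0).card : ℝ) ≤ s
  have h1 : (S.card : ℝ) * Real.exp (-(s * y)) ≤ Real.exp 1 := by
    calc (S.card : ℝ) * Real.exp (-(s * y)) = ∑ _w ∈ S, Real.exp (-(s * y)) := by simp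
      _ ≤ ∑ w ∈ S, Real.exp (-y) ^ (Finset.univ.filter fun j => w j ≠ 0).card := by
          refine Finset.sum_le_sum fun w hw => ?_
          rw [← Real.exp_nat_mul]
          have := mul_le_mul_of_nonneg_right (Finset.mem_filter.1 hw).2 hy0
          exact Real.exp_le_exp.2 (by linarith)
      _ ≤ ∑ w : ι → ZMod p, Real.exp (-y) ^ (Finset.univ.filter fun j => w j ≠ 0).card :=
          Finset.sum_le_sum_of_subset_of_nonneg (Finset.subset_univ _) fun _ _ _ => by positivity
      _ = (1 + (p - 1) * (1 / (p * L))) ^ L := by rw [sum_pow_card_support, hx]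
      _ ≤ Real.exp (1 / L) ^ L := by
          have hp1 : (1 : ℝ) ≤ p := by exact_mod_cast (Fact.out : p.Prime).one_lt.le
          have h2 : (p - 1) * (1 / (p * L)) ≤ 1 / (L : ℝ) := by
            rw [mul_one_div, div_le_div_iff₀ (by positivity) hL]
            nlinarith
          have h3 := Real.add_one_le_exp (1 / (L : ℝ))
          have h4 : 0 ≤ (p - 1) * (1 / (p * (L : ℝ))) :=
            mul_nonneg (by linarith) (by positivity)
          exact pow_le_pow_left₀ (by linarith) (by linarith) _
      _ = Real.exp 1 := by rw [← Real.exp_nat_mul]; congr 1; field_simp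
  calc (S.card : ℝ) = S.card * Real.exp (-(s * y)) * Real.exp (s * y) := by
        rw [mul_assoc, ← Real.exp_add]; simp
    _ ≤ Real.exp 1 * Real.exp (s * y) := mul_le_mul_of_nonneg_right h1 (Real.exp_pos _).le
    _ = _ := by rw [← Real.exp_add]

open Classical in
/-- The total contribution of all vectors to the first moment of a block is bounded. -/
theorem sum_atomBound_pow_le (hp2 : p ≠ 2) {L : ℝ} (hcard : (Fintype.card ι : ℝ) = L)
    (hL : 0 < L) (hlog : 128 ≤ Real.log L) (hp : Real.log p ≤ √L / 64) :
    ∑ w : ι → ZMod p, atomBound w ^ Fintype.card ι ≤ 32 := by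
  have hp0 : (0 : ℝ) < p := by exact_mod_cast (Fact.out : p.Prime).pos
  have hι : 0 < Fintype.card ι := by
    have : (0 : ℝ) < Fintype.card ι := by rw [hcard]; exact hL
    exact_mod_cast this
  have hRl := log_le_sqrt_div hL hlog
  have hRR : √L * √L = L := Real.mul_self_sqrt hL.le
  set K := momentOrder L
  set n := Fintype.card ι with hn
  -- Zero, sparse, compressible and remaining vectors; their totals are at most `1 + 1 + 1 + 29 =
  -- 32`.
  have key : ∀ w : ι → ZMod p, atomBound w ^ n ≤ (if w = 0 then 1 else 0) +
      (if ((Finset.univ.filter fun j => w j ≠ 0).card : ℝ) ≤ √L / 8 then (3 / 4 : ℝ) ^ n else 0) +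
      (if IsCompressible K w then (expSum w / p) ^ n else 0) + ((1 + 3 / L) / p) ^ n := by
    intro w
    have hF := one_le_expSum w
    have i1 : (0 : ℝ) ≤ if w = 0 then 1 else 0 := by split_ifs <;> norm_num
    have i2 : (0 : ℝ) ≤ if ((Finset.univ.filter fun j => w j ≠ 0).card : ℝ) ≤ √L / 8 then
      (3 / 4 : ℝ) ^ n else 0 := by split_ifs <;> positivity
    have i3 : 0 ≤ if IsCompressible K w then (expSum w / p) ^ n else 0 := by
      split_ifs
      · positivity
      · exact le_rfl
    have i4 : 0 ≤ ((1 + 3 / L) / p) ^ n := by positivity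
    by_cases h0 : w = 0
    · have := pow_le_one₀ (n := n) (atomBound_nonneg w) (atomBound_le_one w)
      rw [if_pos h0] at i1 ⊢
      linarith
    by_cases h1 : ((Finset.univ.filter fun j => w j ≠ 0).card : ℝ) ≤ √L / 8
    · have := pow_le_pow_left₀ (atomBound_nonneg w) (atomBound_le_three_quarters hp2 h0) n
      rw [if_pos h1] at i2 ⊢
      linarith
    have ha := atomBound_le_expSum hp2 w
    by_cases h2 : IsCompressible K w
    · have := pow_le_pow_left₀ (atomBound_nonneg w) ha n
      rw [if_pos h2] at i3 ⊢
      linarith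
    · have h3 := expSum_le_of_not_isCompressible hcard hL hlog hp h2 (not_le.1 h1)
      have := pow_le_pow_left₀ (atomBound_nonneg w)
        (ha.trans (div_le_div_of_nonneg_right h3 hp0.le)) n
      linarith
  have s1 : ∑ w : ι → ZMod p, (if w = 0 then (1 : ℝ) else 0) = 1 := by simp
  have s2 : ∑ w : ι → ZMod p, (if ((Finset.univ.filter fun j => w j ≠ 0).card : ℝ) ≤ √L / 8 then
      (3 / 4 : ℝ) ^ n else 0) ≤ 1 := by
    rw [← Finset.sum_filter, Finset.sum_const, nsmul_eq_mul]
    have h34 : (3 / 4 : ℝ) ≤ Real.exp (-(1 / 4)) := by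
      have := Real.add_one_le_exp (-(1 / 4) : ℝ); linarith
    calc _ ≤ Real.exp (1 + √L / 8 * (Real.log p + Real.log L)) * Real.exp (-(1 / 4)) ^ n := by
          refine mul_le_mul ?_ (pow_le_pow_left₀ (by norm_num) h34 n) (by positivity)
            (Real.exp_pos _).le
          rw [← hcard]
          exact card_sparse_le hι
      _ ≤ 1 := by
          rw [← Real.exp_nat_mul, ← Real.exp_add, Real.exp_le_one_iff, hcard]
          -- The entropy of sparse vectors is at most `L / 256`, well below the gain `L / 4`.
          have : √L / 8 * (Real.log p + Real.log L) ≤ √L / 8 * (√L / 64 + √L / 64) :=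
            mul_le_mul_of_nonneg_left (by linarith) (by positivity)
          nlinarith
  have s3 : ∑ w : ι → ZMod p, (if IsCompressible K w then (expSum w / p) ^ n else 0) ≤ 1 := by
    rw [← Finset.sum_filter]
    refine (sum_compressible K).trans ?_
    rw [one_div, inv_pow, mul_inv_le_iff₀ (by positivity), one_mul]
    have hK : (K : ℝ) ≤ √L * Real.log L / 8 + 1 := momentOrder_le hlog
    have h2n : (n : ℝ) ≤ 2 ^ n := by exact_mod_cast Nat.lt_two_pow_self.le
    rw [hcard] at h2n
    nlinarith
  have s4 : ∑ _w : ι → ZMod p, ((1 + 3 / L) / p) ^ n ≤ 29 := by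
    rw [Finset.sum_const, Finset.card_univ, Fintype.card_fun, ZMod.card, nsmul_eq_mul, div_pow,
      ← hn, Nat.cast_pow, mul_div_cancel₀ _ (by positivity)]
    calc (1 + 3 / L) ^ n ≤ Real.exp (3 / L) ^ n := by
          have := Real.add_one_le_exp (3 / L)
          exact pow_le_pow_left₀ (by positivity) (by linarith) n
      _ = Real.exp 3 := by rw [← Real.exp_nat_mul, hcard, mul_div_cancel₀ _ hL.ne']
      _ ≤ 29 := by
          have h := Real.exp_one_lt_d9
          have e : Real.exp 3 = Real.exp 1 ^ 3 := by rw [← Real.exp_nat_mul]; norm_num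
          rw [e]
          calc Real.exp 1 ^ 3 ≤ 3 ^ 3 := pow_le_pow_left₀ (Real.exp_pos _).le (by linarith) 3
            _ ≤ 29 := by norm_num
  refine (Finset.sum_le_sum fun w _ => key w).trans ?_
  rw [Finset.sum_add_distrib, Finset.sum_add_distrib, Finset.sum_add_distrib]
  linarith

end

/-! ### First moment of the number of kernel vectors modulo `p` -/

section Probability

variable {Ω : Type*} {p : ℕ} [Fact p.Prime]

/-- The event that the vector `v` lies in the kernel of `A` modulo `p`. -/
def kernelEvent {n : ℕ} (A : Fin n → Fin n → Ω → ℤ) (v : Fin n → ZMod p) : Set Ω :=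
  {ω | ∀ i, ∑ j, (A i j ω : ZMod p) * v j = 0}

/-- The determinant is an integer, so it also vanishes modulo `p`; the unit multiples of one nonzero
kernel vector are `p - 1` distinct kernel vectors. -/
theorem le_card_kernel_of_mem_singularEvent {n : ℕ} {A : Fin n → Fin n → Ω → ℤ} {ω : Ω}
    (hω : ω ∈ singularEvent A) :
    p - 1 ≤ (Set.ncard {v : Fin n → ZMod p | ω ∈ kernelEvent A v}) := by
  have h0 : (Matrix.of fun i j => A i j ω).det = 0 := by
    have h1 : ((Int.castRingHom ℝ) (Matrix.of fun i j => A i j ω).det) = 0 := by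
      rw [RingHom.map_det]
      exact hω
    exact Int.cast_eq_zero.1 h1
  have h2 : (Matrix.of fun i j => (A i j ω : ZMod p)).det = 0 := by
    have h3 : ((Int.castRingHom (ZMod p)) (Matrix.of fun i j => A i j ω).det) = 0 := by
      rw [h0, map_zero]
    rwa [RingHom.map_det] at h3
  obtain ⟨v, hv, hMv⟩ := Matrix.exists_mulVec_eq_zero_iff.2 h2
  have hinj : Function.Injective fun c : (ZMod p)ˣ => (c : ZMod p) • v := by
    intro c d h
    exact Units.ext (smul_left_injective (ZMod p) hv h)
  have hsub : Set.range (fun c : (ZMod p)ˣ => (c : ZMod p) • v) ⊆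
      {v : Fin n → ZMod p | ω ∈ kernelEvent A v} := by
    rintro _ ⟨c, rfl⟩ i
    have := congrFun hMv i
    simp only [Matrix.mulVec, dotProduct, Matrix.of_apply, Pi.zero_apply] at this
    calc ∑ j, (A i j ω : ZMod p) * ((c : ZMod p) • v) j
        = c * ∑ j, (A i j ω : ZMod p) * v j := by
          rw [Finset.mul_sum]
          exact Finset.sum_congr rfl fun j _ => by simp only [Pi.smul_apply, smul_eq_mul]; ring
      _ = 0 := by rw [this, mul_zero]
  calc p - 1 = Nat.card (ZMod p)ˣ := by rw [Nat.card_eq_fintype_card, ZMod.card_units]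
    _ = (Set.range fun c : (ZMod p)ˣ => (c : ZMod p) • v).ncard := by
        rw [← Set.image_univ, Set.ncard_image_of_injective _ hinj, Set.ncard_univ]
    _ ≤ _ := Set.ncard_le_ncard hsub (Set.toFinite _)

variable [MeasurableSpace Ω] {P : Measure Ω} [IsProbabilityMeasure P]

theorem norm_integral_stdAddChar_le_one (X : Ω → ℤ) (a : ZMod p) :
    ‖∫ ω, (ZMod.stdAddChar (a * (X ω : ZMod p)) : ℂ) ∂P‖ ≤ 1 := by
  have := norm_integral_le_of_norm_le_const (μ := P) (C := 1)
    (Filter.Eventually.of_forall fun ω => (norm_stdAddChar (a * (X ω : ZMod p))).le)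
  simpa using this

theorem integral_stdAddChar_of_isUniformSign {X : Ω → ℤ} (hX : Measurable X)
    (hu : IsUniformSign P X) (a : ZMod p) :
    ∫ ω, (ZMod.stdAddChar (a * (X ω : ZMod p)) : ℂ) ∂P = cosChar a := by
  have m1 : MeasurableSet {ω | X ω = 1} := hX (measurableSet_singleton 1)
  have m2 : MeasurableSet {ω | X ω = -1} := hX (measurableSet_singleton (-1))
  have hdisj : Disjoint {ω | X ω = 1} {ω | X ω = -1} := by
    rw [Set.disjoint_left]
    intro ω h1 h2
    simp only [Set.mem_ofPred_eq] at h1 h2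
    omega
  have hae : ∀ᵐ ω ∂P, X ω = 1 ∨ X ω = -1 := by
    have hm : MeasurableSet ({ω | X ω = 1} ∪ {ω | X ω = -1}) := m1.union m2
    have h1 : P.real ({ω | X ω = 1} ∪ {ω | X ω = -1}) = 1 := by
      rw [measureReal_union hdisj m2, hu.1, hu.2]; norm_num
    have h2 : P ({ω | X ω = 1} ∪ {ω | X ω = -1}) = 1 := by
      rw [measureReal_def] at h1
      rw [← ENNReal.ofReal_toReal (measure_ne_top P _), h1, ENNReal.ofReal_one]
    exact (prob_compl_eq_zero_iff hm).2 h2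
  have heq : (fun ω => (ZMod.stdAddChar (a * (X ω : ZMod p)) : ℂ)) =ᵐ[P] fun ω =>
      {ω | X ω = 1}.indicator (fun _ => (ZMod.stdAddChar a : ℂ)) ω +
      {ω | X ω = -1}.indicator (fun _ => (ZMod.stdAddChar (-a) : ℂ)) ω := by
    filter_upwards [hae] with ω hω
    rcases hω with h | h <;> simp [Set.indicator, h]
  rw [integral_congr_ae heq, integral_add, integral_indicator_const _ m1,
    integral_indicator_const _ m2, hu.1, hu.2, AddChar.map_neg_eq_conj]
  · apply Complex.ext
    · simp [cosChar]; ring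
    · simp
  · exact (integrable_const _).indicator m1
  · exact (integrable_const _).indicator m2

theorem prod_indicator_eq_sum_stdAddChar {n : ℕ} (y : Fin n → ZMod p) :
    (if ∀ i, y i = 0 then (1 : ℂ) else 0) =
      ((p : ℂ) ^ n)⁻¹ * ∑ t : Fin n → ZMod p, ∏ i, ZMod.stdAddChar (t i * y i) := by
  have hp : (p : ℂ) ≠ 0 := by exact_mod_cast (Fact.out : p.Prime).ne_zero
  have h := Finset.prod_univ_sum (fun _ : Fin n => (Finset.univ : Finset (ZMod p)))
    (fun i s => (ZMod.stdAddChar (s * y i) : ℂ))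
  rw [Fintype.piFinset_univ] at h
  rw [← h]
  simp_rw [sum_stdAddChar_mul]
  split_ifs with hy
  · simp [hy, hp]
  · obtain ⟨i, hi⟩ := not_forall.1 hy
    rw [Finset.prod_eq_zero (Finset.mem_univ i) (if_neg hi), mul_zero]

theorem stdAddChar_sum {ι : Type*} (s : Finset ι) (f : ι → ZMod p) :
    (ZMod.stdAddChar (∑ i ∈ s, f i) : ℂ) = ∏ i ∈ s, ZMod.stdAddChar (f i) := by
  classical
  induction s using Finset.induction_on with
  | empty => simp
  | insert a s ha ih => rw [Finset.sum_insert ha, Finset.prod_insert ha, AddChar.map_add_eq_mul, ih]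

theorem prod_stdAddChar_mulVec {n : ℕ} (a : Fin n → Fin n → ZMod p) (t v : Fin n → ZMod p) :
    ∏ i, ZMod.stdAddChar (t i * ∑ j, a i j * v j) =
      ∏ q : Fin n × Fin n, (ZMod.stdAddChar (t q.1 * v q.2 * a q.1 q.2) : ℂ) := by
  rw [Fintype.prod_prod_type]
  refine Finset.prod_congr rfl fun i _ => ?_
  rw [Finset.mul_sum, stdAddChar_sum]
  exact Finset.prod_congr rfl fun j _ => by congr 1; ring

theorem measurableSet_kernelEvent {n : ℕ} {A : Fin n → Fin n → Ω → ℤ}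
    (hA : ∀ i j, Measurable (A i j)) (v : Fin n → ZMod p) : MeasurableSet (kernelEvent A v) := by
  have hm : Measurable fun ω => fun q : Fin n × Fin n => A q.1 q.2 ω :=
    measurable_pi_lambda _ fun q => hA q.1 q.2
  exact hm (MeasurableSet.of_discrete
    (s := {a : Fin n × Fin n → ℤ | ∀ i, ∑ j, (a (i, j) : ZMod p) * v j = 0}))

variable {κ : Type*} [DecidableEq κ]

/-- Expand the indicator of `Av = 0` in characters; by independence its expectation is a product
over entries. Taking absolute values, entries in diagonal blocks contribute cosines and all others
at most 1, after which the sum over `t` factors over rows. -/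
theorem measureReal_kernelEvent_le {n : ℕ} {A : Fin n → Fin n → Ω → ℤ} (hA : HasIndepEntries P A)
    (β : Fin n → κ) (hu : ∀ i j, β i = β j → IsUniformSign P (A i j)) (v : Fin n → ZMod p) :
    P.real (kernelEvent A v) ≤ ∏ i, atomBound fun j : {j // β j = β i} => v j := by
  have hp : (0 : ℝ) < p := by exact_mod_cast (Fact.out : p.Prime).pos
  have hS := measurableSet_kernelEvent hA.measurable v
  have hmeas : ∀ (t : Fin n → ZMod p) (q : Fin n × Fin n), Measurable fun x : ℤ =>
      (ZMod.stdAddChar (t q.1 * v q.2 * (x : ZMod p)) : ℂ) := fun _ _ => measurable_from_top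
  have hint : ∀ t : Fin n → ZMod p, Integrable (fun ω => ∏ q : Fin n × Fin n,
      (ZMod.stdAddChar (t q.1 * v q.2 * (A q.1 q.2 ω : ZMod p)) : ℂ)) P := by
    intro t
    refine Integrable.of_bound (C := 1) ?_ (Filter.Eventually.of_forall fun ω => ?_)
    · exact (Finset.measurable_prod _ fun q _ =>
        (hmeas t q).comp (hA.measurable q.1 q.2)).aestronglyMeasurable
    · rw [norm_prod]
      exact (Finset.prod_congr rfl fun q _ => norm_stdAddChar _).trans_le (by simp)
  have h1 : ((P.real (kernelEvent A v) : ℝ) : ℂ) = ((p : ℂ) ^ n)⁻¹ * ∑ t : Fin n → ZMod p,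
      ∏ q : Fin n × Fin n,
        ∫ ω, (ZMod.stdAddChar (t q.1 * v q.2 * (A q.1 q.2 ω : ZMod p)) : ℂ) ∂P := by
    have e1 : ((P.real (kernelEvent A v) : ℝ) : ℂ) =
        ∫ ω, (kernelEvent A v).indicator (fun _ => (1 : ℂ)) ω ∂P := by
      rw [integral_indicator_const _ hS]; simp
    have e2 : ∀ ω, (kernelEvent A v).indicator (fun _ => (1 : ℂ)) ω =
        ((p : ℂ) ^ n)⁻¹ * ∑ t : Fin n → ZMod p, ∏ q : Fin n × Fin n,
          (ZMod.stdAddChar (t q.1 * v q.2 * (A q.1 q.2 ω : ZMod p)) : ℂ) := by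
      intro ω
      have := prod_indicator_eq_sum_stdAddChar fun i => ∑ j, (A i j ω : ZMod p) * v j
      simp_rw [prod_stdAddChar_mulVec] at this
      rw [← this]
      simp only [Set.indicator, kernelEvent, Set.mem_ofPred_eq]
      congr
    rw [e1, integral_congr_ae (Filter.Eventually.of_forall e2), integral_const_mul,
      integral_finsetSum _ fun t _ => hint t]
    congr 1
    refine Finset.sum_congr rfl fun t _ => ?_
    exact iIndepFun.integral_fun_prod_comp (X := fun q : Fin n × Fin n => A q.1 q.2)
      (f := fun q (x : ℤ) => (ZMod.stdAddChar (t q.1 * v q.2 * (x : ZMod p)) : ℂ)) hA.indep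
      (fun q => (hA.measurable q.1 q.2).aemeasurable) fun q => (hmeas t q).aestronglyMeasurable
  have h2 : ∀ (t : Fin n → ZMod p) (q : Fin n × Fin n),
      ‖∫ ω, (ZMod.stdAddChar (t q.1 * v q.2 * (A q.1 q.2 ω : ZMod p)) : ℂ) ∂P‖ ≤
        if β q.2 = β q.1 then |cosChar (t q.1 * v q.2)| else 1 := by
    intro t q
    split_ifs with h
    · rw [integral_stdAddChar_of_isUniformSign (hA.measurable q.1 q.2) (hu _ _ h.symm),
        Complex.norm_real, Real.norm_eq_abs]
    · exact norm_integral_stdAddChar_le_one _ _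
  have h3 : P.real (kernelEvent A v) ≤ ((p : ℝ) ^ n)⁻¹ * ∑ t : Fin n → ZMod p,
      ∏ q : Fin n × Fin n, if β q.2 = β q.1 then |cosChar (t q.1 * v q.2)| else 1 := by
    have e : P.real (kernelEvent A v) = ‖((P.real (kernelEvent A v) : ℝ) : ℂ)‖ := by
      rw [Complex.norm_real, Real.norm_of_nonneg measureReal_nonneg]
    rw [e, h1, norm_mul, norm_inv, norm_pow, Complex.norm_natCast]
    refine mul_le_mul_of_nonneg_left ?_ (by positivity)
    refine (norm_sum_le _ _).trans (Finset.sum_le_sum fun t _ => ?_)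
    rw [norm_prod]
    exact Finset.prod_le_prod (fun _ _ => norm_nonneg _) fun q _ => h2 t q
  refine h3.trans (le_of_eq ?_)
  have h4 := Finset.prod_univ_sum (fun _ : Fin n => (Finset.univ : Finset (ZMod p)))
    (fun i s => ∏ j, if β j = β i then |cosChar (s * v j)| else 1)
  rw [Fintype.piFinset_univ] at h4
  simp_rw [Fintype.prod_prod_type]
  rw [← h4]
  simp_rw [atomBound]
  rw [Finset.prod_mul_distrib, Finset.prod_const, Finset.card_univ, Fintype.card_fin, inv_pow]
  congr 1
  refine Finset.prod_congr rfl fun i _ => Finset.sum_congr rfl fun s _ => ?_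
  rw [← Finset.prod_filter]
  exact Finset.prod_subtype _ (by simp) _

/-- All rows of a block share the same factor, which produces the power, and a vector is a free
choice of its restrictions to the blocks. -/
theorem sum_prod_atomBound [Fintype κ] {n : ℕ} (β : Fin n → κ) :
    ∑ v : Fin n → ZMod p, ∏ i, atomBound (fun j : {j // β j = β i} => v j) =
      ∏ k, ∑ w : {j // β j = k} → ZMod p, atomBound w ^ Fintype.card {j // β j = k} := by
  rw [Finset.prod_univ_sum, Fintype.piFinset_univ]
  let e : (Fin n → ZMod p) ≃ ((k : κ) → {j // β j = k} → ZMod p) :=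
    { toFun := fun v _ j => v j
      invFun := fun x i => x (β i) ⟨i, rfl⟩
      left_inv := fun v => rfl
      right_inv := fun x => by
        funext k j
        obtain ⟨j, rfl⟩ := j
        rfl }
  refine Fintype.sum_equiv e _ _ fun v => ?_
  rw [← Finset.prod_fiberwise Finset.univ β]
  refine Finset.prod_congr rfl fun k _ => ?_
  rw [Finset.prod_congr rfl (g := fun _ => atomBound (e v k)), Finset.prod_const,
    Fintype.card_subtype]
  intro i hi
  have hk := (Finset.mem_filter.1 hi).2
  subst hk
  rfl

/-- Nonzero kernel vectors modulo `p` come in lines, so the first moment of their number bounds the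
singularity probability with an additional factor `1 / (p - 1)`. -/
theorem measureReal_singularEvent_le {n : ℕ} {A : Fin n → Fin n → Ω → ℤ}
    (hA : ∀ i j, Measurable (A i j)) :
    ((p : ℝ) - 1) * P.real (singularEvent A) ≤
      ∑ v : Fin n → ZMod p, P.real (kernelEvent A v) := by
  classical
  have hmS := fun v : Fin n → ZMod p => measurableSet_kernelEvent hA v
  let N : Ω → ℝ := fun ω => ∑ v : Fin n → ZMod p, (kernelEvent A v).indicator (fun _ => 1) ω
  have hiv : ∀ v : Fin n → ZMod p,
      Integrable ((kernelEvent A v).indicator (fun _ => (1 : ℝ))) P :=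
    fun v => (integrable_const _).indicator (hmS v)
  have hN0 : 0 ≤ᵐ[P] N := Filter.Eventually.of_forall fun ω =>
    Finset.sum_nonneg fun v _ => Set.indicator_nonneg (fun _ _ => zero_le_one) ω
  have hNi : Integrable N P := integrable_finsetSum _ fun v _ => hiv v
  have hp1 : (1 : ℝ) < p := by exact_mod_cast (Fact.out : p.Prime).one_lt
  have hsub : singularEvent A ⊆ {ω | (p : ℝ) - 1 ≤ N ω} := by
    intro ω hω
    have h := le_card_kernel_of_mem_singularEvent (p := p) hω
    have e : N ω = Set.ncard {v : Fin n → ZMod p | ω ∈ kernelEvent A v} := by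
      rw [Set.ncard_eq_toFinset_card']
      simp [N, Set.indicator]
    have h' : ((p - 1 : ℕ) : ℝ) ≤ N ω := by rw [e]; exact_mod_cast h
    rwa [Nat.cast_sub (Fact.out : p.Prime).one_lt.le, Nat.cast_one] at h'
  calc ((p : ℝ) - 1) * P.real (singularEvent A)
      ≤ ((p : ℝ) - 1) * P.real {ω | (p : ℝ) - 1 ≤ N ω} :=
        mul_le_mul_of_nonneg_left (measureReal_mono hsub) (by linarith)
    _ ≤ ∫ ω, N ω ∂P := mul_meas_ge_le_integral_of_nonneg hN0 hNi _
    _ = ∑ v : Fin n → ZMod p, P.real (kernelEvent A v) := by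
        rw [integral_finsetSum _ fun v _ => hiv v]
        refine Finset.sum_congr rfl fun v _ => ?_
        rw [integral_indicator_const _ (hmS v)]
        simp

theorem singular_le_of_blocks [Fintype κ] {n : ℕ} {A : Fin n → Fin n → Ω → ℤ}
    (hA : HasIndepEntries P A) (hp2 : p ≠ 2) (β : Fin n → κ)
    (hu : ∀ i j, β i = β j → IsUniformSign P (A i j))
    (hlog : ∀ k, 128 ≤ Real.log (Fintype.card {j // β j = k}))
    (hp : ∀ k, Real.log p ≤ √(Fintype.card {j // β j = k}) / 64) :
    ((p : ℝ) - 1) * P.real (singularEvent A) ≤ 32 ^ Fintype.card κ := by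
  refine (measureReal_singularEvent_le hA.measurable).trans ?_
  refine (Finset.sum_le_sum fun v _ => measureReal_kernelEvent_le hA β hu v).trans ?_
  rw [sum_prod_atomBound]
  refine (Finset.prod_le_prod (g := fun _ => 32) (fun k _ => Finset.sum_nonneg fun w _ =>
    pow_nonneg (atomBound_nonneg w) _) fun k _ => ?_).trans_eq (by simp)
  refine le_trans (le_of_eq ?_) (sum_atomBound_pow_le hp2 rfl ?_ (hlog k) (hp k))
  · congr!
  -- An empty block is excluded because `Real.log 0 = 0` by convention.
  by_contra h
  have h0 : ((Fintype.card {j // β j = k} : ℕ) : ℝ) = 0 := le_antisymm (not_lt.1 h) (by positivity)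
  have := hlog k
  rw [h0, Real.log_zero] at this
  linarith

end Probability

/-! ### Partition of the indices into consecutive blocks -/

section Blocks

/-- The partition of `Fin n` into `n / b` consecutive blocks of length at least `b`; the last block
absorbs the remainder. -/
def blockIndex {n b : ℕ} (h : 0 < n / b) (i : Fin n) : Fin (n / b) :=
  ⟨min (i / b) (n / b - 1), by omega⟩

theorem abs_sub_lt_of_blockIndex_eq {n b : ℕ} (h : 0 < n / b) (hb : 0 < b) {i j : Fin n}
    (hij : blockIndex h i = blockIndex h j) : |(i : ℤ) - (j : ℤ)| < 2 * b := by
  have h1 : min ((i : ℕ) / b) (n / b - 1) = min ((j : ℕ) / b) (n / b - 1) := congrArg Fin.val hij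
  obtain ⟨m, hm⟩ : ∃ m, n / b = m + 1 := ⟨n / b - 1, by omega⟩
  have hn := Nat.lt_mul_div_succ n hb
  have aux : ∀ x : Fin n, b * min ((x : ℕ) / b) (n / b - 1) ≤ x ∧
      (x : ℕ) < b * min ((x : ℕ) / b) (n / b - 1) + 2 * b := by
    intro x
    have hx := x.2
    have hx1 := Nat.lt_mul_div_succ (x : ℕ) hb
    have hx2 := Nat.mul_div_le (x : ℕ) b
    rw [mul_add] at hx1 hn
    rw [hm] at hn ⊢
    rw [mul_add] at hn
    rcases le_total ((x : ℕ) / b) (m + 1 - 1) with hc | hc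
    · rw [min_eq_left hc]
      omega
    · rw [min_eq_right hc, Nat.add_sub_cancel]
      rw [Nat.add_sub_cancel] at hc
      have := Nat.mul_le_mul_left b hc
      omega
  have hi := aux i
  have hj := aux j
  rw [h1] at hi
  rw [abs_lt]
  omega

theorem le_card_blockIndex {n b : ℕ} (h : 0 < n / b) (k : Fin (n / b)) :
    b ≤ Fintype.card {j : Fin n // blockIndex h j = k} := by
  have hk := k.2
  have hlt : ∀ r : Fin b, b * (k : ℕ) + r < n := by
    intro r
    have h1 := Nat.mul_div_le n b
    have h2 := Nat.mul_le_mul_left b (Nat.succ_le_of_lt hk)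
    rw [Nat.mul_succ] at h2
    have := r.2
    omega
  have hmem : ∀ r : Fin b, blockIndex h ⟨b * (k : ℕ) + r, hlt r⟩ = k := by
    intro r
    have hb : 0 < b := r.pos
    apply Fin.ext
    simp only [blockIndex]
    rw [Nat.mul_add_div hb, Nat.div_eq_of_lt r.2]
    omega
  have := Fintype.card_le_of_injective
    (fun r : Fin b => (⟨⟨b * (k : ℕ) + r, hlt r⟩, hmem r⟩ : {j : Fin n // blockIndex h j = k}))
    (fun r s hrs => by
      have := congrArg (fun x => ((x : {j : Fin n // blockIndex h j = k}) : ℕ)) hrs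
      exact Fin.ext (by simpa using this))
  simpa using this

end Blocks

/-! ### Choice of the prime, the asymptotics, and the two models -/

theorem IsRandomBand.singular_le {Ω : Type*} [MeasurableSpace Ω] {P : Measure Ω}
    [IsProbabilityMeasure P] {n : ℕ} {d : ℤ} {A : Fin n → Fin n → Ω → ℤ} (hA : IsRandomBand P d A)
    {b : ℕ} (hbd : 2 * (b : ℤ) ≤ d) (hbn : b ≤ n) (hlog : 128 ≤ Real.log b) :
    P.real (singularEvent A) ≤ 32 ^ (n / b) * (4 * Real.exp (-(√b / 64))) := by
  have hb : 0 < b := by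
    by_contra h
    have : b = 0 := by omega
    rw [this, Nat.cast_zero, Real.log_zero] at hlog
    linarith
  have hbR : (0 : ℝ) < b := by exact_mod_cast hb
  have hnb : 0 < n / b := Nat.div_pos hbn hb
  set x := Real.exp (√b / 64) with hx
  have hx4 : 8 ≤ x := by
    have h1 := log_le_sqrt_div hbR hlog
    have h2 := Real.add_one_le_exp (√b / 64)
    linarith
  set N := ⌊x / 2⌋₊
  have hN : (N : ℝ) ≤ x / 2 := Nat.floor_le (by positivity)
  have hN' : x / 2 < N + 1 := Nat.lt_floor_add_one _
  have hN2 : 2 ≤ N := Nat.le_floor (by push_cast; linarith)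
  -- Bertrand's postulate with `N = ⌊x / 2⌋` keeps `p ≤ x`, as the block bound requires, yet `p - 1
  -- ≥ x / 4`; `N ≥ 2` makes `p` odd.
  obtain ⟨p, hpp, hNp, hpN⟩ := Nat.exists_prime_lt_and_le_two_mul N (by omega)
  have : Fact p.Prime := ⟨hpp⟩
  have hp0 : (0 : ℝ) < p := by exact_mod_cast hpp.pos
  have hpx : Real.log p ≤ √b / 64 := by
    rw [Real.log_le_iff_le_exp hp0]
    have : (p : ℝ) ≤ 2 * N := by exact_mod_cast hpN
    linarith
  have hcard : ∀ k, (b : ℝ) ≤ Fintype.card {j : Fin n // blockIndex hnb j = k} := fun k => by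
    exact_mod_cast le_card_blockIndex hnb k
  have key := singular_le_of_blocks (p := p) hA.toHasIndepEntries (by omega) (blockIndex hnb)
    (fun i j hij => hA.uniform i j ((abs_sub_lt_of_blockIndex_eq hnb hb hij).le.trans hbd))
    (fun k => hlog.trans (Real.log_le_log hbR (hcard k)))
    (fun k => hpx.trans (div_le_div_of_nonneg_right (Real.sqrt_le_sqrt (hcard k)) (by norm_num)))
  rw [Fintype.card_fin] at key
  have hp4 : x / 4 ≤ (p : ℝ) - 1 := by
    have : (N : ℝ) + 1 ≤ p := by exact_mod_cast hNp
    linarith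
  have h1 : x / 4 * P.real (singularEvent A) ≤ 32 ^ (n / b) :=
    (mul_le_mul_of_nonneg_right hp4 measureReal_nonneg).trans key
  rw [Real.exp_neg, ← hx]
  have h2 : P.real (singularEvent A) = x / 4 * P.real (singularEvent A) * (4 * x⁻¹) := by
    field_simp
  rw [h2]
  exact mul_le_mul_of_nonneg_right h1 (by positivity)

/-- The exponent `3α/2 - 1 = α/2 - (1 - α)` is positive exactly when `α > 2/3`; this is where that
condition enters. -/
theorem exists_threshold {α : ℝ} (h1 : 2 / 3 < α) :
    ∃ N : ℕ, ∀ n : ℕ, N ≤ n → 1 ≤ n ∧ 4 * Real.exp 128 ≤ (n : ℝ) ^ α ∧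
      5000 ≤ (n : ℝ) ^ (3 * α / 2 - 1) := by
  have t : ∀ y : ℝ, 0 < y → Filter.Tendsto (fun n : ℕ => (n : ℝ) ^ y) Filter.atTop Filter.atTop :=
    fun y hy => (tendsto_rpow_atTop hy).comp tendsto_natCast_atTop_atTop
  have h := (Filter.eventually_ge_atTop 1).and
    (((t α (by linarith)).eventually_ge_atTop (4 * Real.exp 128)).and
      ((t (3 * α / 2 - 1) (by linarith)).eventually_ge_atTop 5000))
  exact Filter.eventually_atTop.1 h

theorem IsRandomBand.singular_le_exp {Ω : Type*} [MeasurableSpace Ω] {P : Measure Ω}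
    [IsProbabilityMeasure P] {n : ℕ} {d : ℤ} {A : Fin n → Fin n → Ω → ℤ} (hA : IsRandomBand P d A)
    {α : ℝ} (hα : α < 1) (hn : 1 ≤ n) (hd : (n : ℝ) ^ α ≤ d) (hdn : d ≤ n)
    (h1 : 4 * Real.exp 128 ≤ (n : ℝ) ^ α) (h2 : 5000 ≤ (n : ℝ) ^ (3 * α / 2 - 1)) :
    P.real (singularEvent A) ≤ Real.exp (-(1 / 256) * (n : ℝ) ^ (α / 2)) := by
  have hn0 : (0 : ℝ) < n := by exact_mod_cast hn
  have he : (1 : ℝ) ≤ Real.exp 128 := Real.one_le_exp (by norm_num)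
  obtain ⟨D, rfl⟩ : ∃ D : ℕ, d = D := by
    refine ⟨d.toNat, (Int.toNat_of_nonneg ?_).symm⟩
    have : (0 : ℝ) ≤ d := by linarith
    exact_mod_cast this
  rw [Int.cast_natCast] at hd
  -- Indices in one block differ by less than `2 * b`, the last block being longer than `b`; so `2 *
  -- b ≤ D` suffices.
  set b := D / 2 with hb
  have hbD : (D : ℝ) ≤ 2 * b + 1 := by
    have : D ≤ 2 * b + 1 := by omega
    exact_mod_cast this
  have hb4 : (n : ℝ) ^ α / 4 ≤ b := by linarith
  have hb0 : (0 : ℝ) < b := by linarith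
  have hlog : 128 ≤ Real.log b := by
    rw [Real.le_log_iff_exp_le hb0]
    linarith
  have hbn : b ≤ n := by omega
  refine (hA.singular_le (b := b) (by omega) hbn hlog).trans ?_
  have hsqrt : (n : ℝ) ^ (α / 2) / 2 ≤ √b := by
    refine Real.le_sqrt_of_sq_le ?_
    have e : ((n : ℝ) ^ (α / 2) / 2) ^ 2 = (n : ℝ) ^ α / 4 := by
      rw [div_pow, ← Real.rpow_natCast, ← Real.rpow_mul hn0.le]
      norm_num
    rwa [e]
  have hblocks : ((n / b : ℕ) : ℝ) ≤ 4 * (n : ℝ) ^ (1 - α) := by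
    refine Nat.cast_div_le.trans ?_
    rw [div_le_iff₀ hb0]
    have e : (n : ℝ) ^ (1 - α) * (n : ℝ) ^ α = n := by
      rw [← Real.rpow_add hn0]; simp
    have := mul_le_mul_of_nonneg_left hb4 (by positivity : 0 ≤ 4 * (n : ℝ) ^ (1 - α))
    linarith
  have hsplit : 5000 * (n : ℝ) ^ (1 - α) ≤ (n : ℝ) ^ (α / 2) := by
    have e : (n : ℝ) ^ (α / 2) = (n : ℝ) ^ (3 * α / 2 - 1) * (n : ℝ) ^ (1 - α) := by
      rw [← Real.rpow_add hn0]; congr 1; ring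
    rw [e]
    exact mul_le_mul_of_nonneg_right h2 (by positivity)
  have hone : 1 ≤ (n : ℝ) ^ (1 - α) := Real.one_le_rpow (by exact_mod_cast hn) (by linarith)
  have h32 : (32 : ℝ) ≤ Real.exp 4 := by
    have e : Real.exp 4 = Real.exp 1 ^ 4 := by rw [← Real.exp_nat_mul]; norm_num
    rw [e]
    calc (32 : ℝ) ≤ 2.7 ^ 4 := by norm_num
      _ ≤ Real.exp 1 ^ 4 :=
        pow_le_pow_left₀ (by norm_num) (by linarith [Real.exp_one_gt_d9]) 4
  have h4 : (4 : ℝ) ≤ Real.exp 3 := by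
    have := Real.add_one_le_exp (3 : ℝ); linarith
  calc (32 : ℝ) ^ (n / b) * (4 * Real.exp (-(√b / 64)))
      ≤ Real.exp 4 ^ (n / b) * (Real.exp 3 * Real.exp (-(√b / 64))) := by gcongr
    _ = Real.exp (((n / b : ℕ) : ℝ) * 4 + (3 + -(√b / 64))) := by
        rw [← Real.exp_nat_mul, ← Real.exp_add, ← Real.exp_add]
    -- Here `√b / 64 ≥ n ^ (α/2) / 128`; half of this is the claimed exponent, the other half must
    -- absorb `16 n ^ (1 - α) + 3 ≤ 19 n ^ (1 - α)`, and `19 * 256 ≤ 5000`.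
    _ ≤ _ := Real.exp_le_exp.2 (by linarith)

/-- Indices at distance at most `d` lie in the same or in neighbouring blocks, so the corner blocks
play no role. -/
theorem IsBlockBand.isRandomBand {Ω : Type*} [MeasurableSpace Ω] {P : Measure Ω} {n m d : ℕ}
    {A : Fin n → Fin n → Ω → ℤ} (hA : IsBlockBand P m d A) : IsRandomBand P (d : ℤ) A := by
  refine ⟨hA.toHasIndepEntries, fun i j hij => hA.uniform i j (Or.inl ?_)⟩
  have hd : 0 < d := by
    rcases Nat.eq_zero_or_pos d with h | h
    · have h1 := hA.size
      have h2 := i.2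
      rw [h, mul_zero] at h1
      omega
    · exact h
  rw [abs_le] at hij ⊢
  have h1 : (i : ℕ) / d ≤ (j : ℕ) / d + 1 := by
    rw [← Nat.add_div_right _ hd]
    exact Nat.div_le_div_right (by omega)
  have h2 : (j : ℕ) / d ≤ (i : ℕ) / d + 1 := by
    rw [← Nat.add_div_right _ hd]
    exact Nat.div_le_div_right (by omega)
  omega

theorem theorem1 :
    (∃ C : ℝ, 0 < C ∧ ∀ α : ℝ, 2 / 3 < α → α < 1 →
      ∃ N : ℕ, ∀ n : ℕ, N ≤ n → ∀ d : ℤ, (n : ℝ) ^ α ≤ (d : ℝ) → d ≤ (n : ℤ) →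
        ∀ (Ω : Type*) [MeasurableSpace Ω] (P : Measure Ω) [IsProbabilityMeasure P]
          (A : Fin n → Fin n → Ω → ℤ), IsRandomBand P d A →
          P.real (singularEvent A) ≤ Real.exp (-C * (n : ℝ) ^ (α / 2))) ∧
    (∀ (n : ℕ) (d : ℤ) (Ω : Type*) [MeasurableSpace Ω] (P : Measure Ω) [IsProbabilityMeasure P]
      (A : Fin n → Fin n → Ω → ℤ), IsPeriodicBand P d A → IsRandomBand P d A) ∧
    (∀ (n m d : ℕ) (Ω : Type*) [MeasurableSpace Ω] (P : Measure Ω) [IsProbabilityMeasure P]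
      (A : Fin n → Fin n → Ω → ℤ), IsBlockBand P m d A → IsRandomBand P (d : ℤ) A) := by
  refine ⟨⟨1 / 256, by norm_num, fun α hα hα1 => ?_⟩, ?_, ?_⟩
  · obtain ⟨N, hN⟩ := exists_threshold hα
    refine ⟨N, fun n hn d hd hdn Ω _ P _ A hA => ?_⟩
    obtain ⟨h0, h1, h2⟩ := hN n hn
    exact hA.singular_le_exp hα1 h0 hd hdn h1 h2
  · exact fun n d Ω _ P _ A hA =>
      ⟨hA.toHasIndepEntries, fun i j hij => hA.uniform i j (Or.inl hij)⟩
  · exact fun n m d Ω _ P _ A hA => hA.isRandomBand
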